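/- **Definitions.** Let $n\ge 0$ and $[1,n]=\{1,\dots,n\}$ (empty for $n=0$). A graded poset $P$ is a finite poset with minimum $\hat 0$, maximum $\hat 1$ and a rank function $\rho$ with $\rho(\hat 0)=0$ and $\rho(y)=\rho(x)+1$ whenever $y$ covers $x$; its rank is $\rho(\hat 1)$. It is Eulerian if $\mu([x,y])=(-1)^{\rho(y)-\rho(x)}$ for all $x\le y$, where $\mu$ is the Möbius function. For $P$ of rank $n+1$ and $S\subseteq[1,n]$, $f_S(P)$ is the number of chains of $P$ with set of ranks $S$; $(f_S(P))_{S\subseteq[1,n]}\in\mathbb R^{2^n}$ is the flag vector of $P$. Let $\mathcal C^{n+1}_{\mathcal E}\subseteq\mathbb R^{2^n}$ be the closure of the convex cone (with apex $0$) generated by the flag vectors of all Eulerian posets of rank $n+1$. A facet of a closed convex cone is a face whose dimension is one less than that of the cone; an extreme ray is a face that is a ray $\{tv:t\ge 0\}$ with $v\neq 0$. For a graded poset $P$ of rank $n+1$, a nonempty interval $I=[a,b]\subseteq[1,n]$ and $k\ge 1$, let $D_I^k(P)$ be the poset obtained by replacing each $x\in P$ with $\rho(x)\in I$ by $k$ copies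 $x_1,\dots,x_k$; comparisons in which at most one of the two ranks lies in $I$ are inherited from $P$, and if $\rho(x),\rho(y)\in I$ then $x_i<y_j$ if and only if $i=j$ and $x<y$. The horizontal double $DP$ is obtained by applying $D^2_{[i,i]}$ for all $i\in[1,n]$. An interval system on $[1,n]$ is a set $\mathcal I$ of nonempty subintervals of $[1,n]$, none contained in another; it is even if $|I\cap J|$ is even for all $I,J\in\mathcal I$ (including $I=J$). Let $P(n,\mathcal I,N)$ be obtained from the chain of rank $n+1$ by applying $D_I^N$ for all $I\in\mathcal I$. The flag vector of the doubled limit poset $DP(n,\mathcal I)$ is defined by $$f_S(DP(n,\mathcal I))=\lim_{N\to\infty}N^{-|\mathcal I|}f_S(D\,P(n,\mathcal I,N)),\qquad S\subseteq[1,n].$$ For a vector $f=(f_S)_{S\subseteq[1,n]}$ put $$L_S(f)=(-1)^{n-|S|}\sum_{[1,n]\setminus S\subseteq T\subseteq[1,n]}\left(-\tfrac12\right)^{|T|}f_T .$$ Call a pair $M\subseteq V\subseteq[1,n]$ admissible if every maximal interval of $V$ has at least $2$ elements, every maximal interval of $\{0,1,\dots,n+1\}\setminus V$ has at most $3$ elements,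 and every maximal interval $[a,b]$ of $V$ satisfies: (i) $M\cap[a,b]$ is $\emptyset$, $[a,a+1]$ or $[b-1,b]$; (ii) if $a\notin M$ then $a-2\in\{-1\}\cup M$; (iii) if $b\notin M$ then $b+2\in\{n+2\}\cup M$. **Theorem.** Let $n\ge 0$ and $n+1\le 6$. Then the closed cone $\mathcal C^{n+1}_{\mathcal E}$ is finitely generated. 1. For every even interval system $\mathcal I$ on $[1,n]$ the limits defining $f_S(DP(n,\mathcal I))$ exist. The cone has exactly $\binom{n}{\lfloor n/2\rfloor}$ extreme rays, and they are exactly the rays generated by the flag vectors of $DP(n,\mathcal I)$, for $\mathcal I$ an even interval system on $[1,n]$. 2. The inequality $\sum_{Q\subseteq[1,n]}L_Q\ge 0$ and, for every admissible pair $(M,V)$, the inequality $(-1)^{|M|/2}\sum_{M\subseteq Q\subseteq V}L_Q\ge 0$ hold on $\mathcal C^{n+1}_{\mathcal E}$. The cone has exactly $\binom{n}{\lfloor n/2\rfloor}$ facets, and they are exactly the sets of points of the cone at which equality holds in one of these inequalities. -/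

import Mathlib

open Filter Topology

/-- A finite graded poset: a finite partial order with a minimum `⊥`, a maximum `⊤`, and a rank
function `grade ℕ` that is `0` at `⊥` and goes up by exactly one along every covering relation. -/
structure GradedPoset where
  carrier : Type
  [instPartialOrder : PartialOrder carrier]
  [instBoundedOrder : BoundedOrder carrier]
  [instFintype : Fintype carrier]
  [instGrade : GradeMinOrder ℕ carrier]

namespace GradedPoset

attribute [instance] instPartialOrder instBoundedOrder instFintype instGrade

instance : CoeSort GradedPoset Type := ⟨GradedPoset.carrier⟩

/-- The rank function `ρ` of a graded poset. -/
def rk (P : GradedPoset) (x : P) : ℕ := grade ℕ x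

/-- The rank of a graded poset is the rank of its maximum. -/
def rank (P : GradedPoset) : ℕ := P.rk ⊤

/-- The flag number `f_S(P)`: the number of chains of `P` whose set of ranks is `S`. -/
noncomputable def flagNumber (P : GradedPoset) (S : Finset ℕ) : ℕ :=
  Nat.card {c : Finset P // IsChain (· ≤ ·) (c : Set P) ∧ c.image P.rk = S}

open Classical in
/-- The Möbius function of the interval `[x, y]`. -/
noncomputable def mobius (P : GradedPoset) (x y : P) : ℤ :=
  letI : LocallyFiniteOrder P := Fintype.toLocallyFiniteOrder
  IncidenceAlgebra.mu ℤ x y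

/-- `P` is Eulerian if `μ([x, y]) = (-1) ^ (ρ(y) - ρ(x))` for every interval `[x, y]`. -/
def IsEulerian (P : GradedPoset) : Prop :=
  ∀ x y : P, x ≤ y → P.mobius x y = (-1) ^ (P.rk y - P.rk x)

/-- The element `x` of `P \ {⊥, ⊤}` has rank in the interval `[a, b]`. -/
def InInterval (P : GradedPoset) (a b : ℕ) (x : P) : Prop :=
  x ≠ ⊥ ∧ x ≠ ⊤ ∧ a ≤ P.rk x ∧ P.rk x ≤ b

/-- The elements of `D_I^k(P)` for `I = [a, b]`: the `k` copies `(x, 0), …, (x, k - 1)` of each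
`x` whose rank is in `I`, and a single copy `(x, 0)` of every other `x`. -/
def ReplicateCarrier (P : GradedPoset) (a b : ℕ) (k : ℕ+) : Type :=
  {p : P.carrier × Fin (k : ℕ) // ¬ P.InInterval a b p.1 → (p.2 : ℕ) = 0}

namespace ReplicateCarrier

variable {P : GradedPoset} {a b : ℕ} {k : ℕ+}

theorem inInterval_of_le {x y z : P} (hxy : x ≤ y) (hyz : y ≤ z) (hx : P.InInterval a b x)
    (hz : P.InInterval a b z) : P.InInterval a b y := by
  obtain ⟨h1, -, h3, -⟩ := hx
  obtain ⟨-, h2, -, h4⟩ := hz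
  refine ⟨?_, ?_, h3.trans ?_, le_trans ?_ h4⟩
  · rintro rfl
    exact h1 (le_bot_iff.1 hxy)
  · rintro rfl
    exact h2 (top_le_iff.1 hyz)
  · exact (grade_strictMono (𝕆 := ℕ)).monotone hxy
  · exact (grade_strictMono (𝕆 := ℕ)).monotone hyz

/-- The copies `x_i ≤ y_j` are comparable exactly when `x ≤ y` and, in case both ranks are in `I`,
`i = j`. -/
instance : PartialOrder (ReplicateCarrier P a b k) where
  le p q := p.1.1 ≤ q.1.1 ∧
    (P.InInterval a b p.1.1 → P.InInterval a b q.1.1 → p.1.2 = q.1.2)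
  le_refl p := ⟨le_rfl, fun _ _ => rfl⟩
  le_trans p q r hpq hqr := by
    refine ⟨hpq.1.trans hqr.1, fun hp hr => ?_⟩
    have hq := inInterval_of_le hpq.1 hqr.1 hp hr
    exact (hpq.2 hp hq).trans (hqr.2 hq hr)
  le_antisymm p q hpq hqp := by
    have h : p.1.1 = q.1.1 := le_antisymm hpq.1 hqp.1
    refine Subtype.ext (Prod.ext h ?_)
    by_cases hp : P.InInterval a b p.1.1
    · exact hpq.2 hp (h ▸ hp)
    · have hq : ¬ P.InInterval a b q.1.1 := h ▸ hp
      exact Fin.ext ((p.2 hp).trans (q.2 hq).symm)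

theorem le_def {p q : ReplicateCarrier P a b k} : p ≤ q ↔ p.1.1 ≤ q.1.1 ∧
    (P.InInterval a b p.1.1 → P.InInterval a b q.1.1 → p.1.2 = q.1.2) := Iff.rfl

theorem eq_of_le_of_fst_eq {p q : ReplicateCarrier P a b k} (h : p ≤ q) (he : p.1.1 = q.1.1) :
    p = q := by
  refine le_antisymm h ⟨he.ge, fun hq hp => (h.2 hp hq).symm⟩

theorem fst_lt_of_lt {p q : ReplicateCarrier P a b k} (h : p < q) : p.1.1 < q.1.1 :=
  lt_of_le_of_ne h.le.1 fun he => h.ne (eq_of_le_of_fst_eq h.le he)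

instance : BoundedOrder (ReplicateCarrier P a b k) where
  bot := ⟨(⊥, ⟨0, k.pos⟩), fun _ => rfl⟩
  bot_le _ := ⟨bot_le, fun h => absurd rfl h.1⟩
  top := ⟨(⊤, ⟨0, k.pos⟩), fun _ => rfl⟩
  le_top _ := ⟨le_top, fun _ h => absurd rfl h.2.1⟩

open Classical in
noncomputable instance : Fintype (ReplicateCarrier P a b k) :=
  inferInstanceAs (Fintype {p : P.carrier × Fin (k : ℕ) //
    ¬ P.InInterval a b p.1 → (p.2 : ℕ) = 0})

theorem fst_covBy {p q : ReplicateCarrier P a b k} (h : p ⋖ q) : p.1.1 ⋖ q.1.1 := by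
  refine ⟨fst_lt_of_lt h.lt, fun z hpz hzq => ?_⟩
  have key : ∃ r : ReplicateCarrier P a b k, r.1.1 = z ∧ p ≤ r ∧ r ≤ q := by
    by_cases hz : P.InInterval a b z
    · by_cases hp : P.InInterval a b p.1.1
      · exact ⟨⟨(z, p.1.2), fun hn => absurd hz hn⟩, rfl, ⟨hpz.le, fun _ _ => rfl⟩,
          ⟨hzq.le, fun _ hq => h.le.2 hp hq⟩⟩
      · exact ⟨⟨(z, q.1.2), fun hn => absurd hz hn⟩, rfl, ⟨hpz.le, fun hp' => absurd hp' hp⟩,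
          ⟨hzq.le, fun _ _ => rfl⟩⟩
    · exact ⟨⟨(z, ⟨0, k.pos⟩), fun _ => rfl⟩, rfl, ⟨hpz.le, fun _ hz' => absurd hz' hz⟩,
          ⟨hzq.le, fun hz' => absurd hz' hz⟩⟩
  obtain ⟨r, rfl, hpr, hrq⟩ := key
  refine h.2 (lt_of_le_of_ne hpr ?_) (lt_of_le_of_ne hrq ?_)
  · rintro rfl
    exact lt_irrefl _ hpz
  · rintro rfl
    exact lt_irrefl _ hzq

instance : GradeMinOrder ℕ (ReplicateCarrier P a b k) where
  grade p := P.rk p.1.1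
  grade_strictMono _ _ h := grade_strictMono (𝕆 := ℕ) (fst_lt_of_lt h)
  covBy_grade _ _ h := (fst_covBy h).grade ℕ
  isMin_grade p hp := by
    have : p = ⊥ := hp.eq_bot
    subst this
    exact IsMin.grade ℕ (isMin_bot : IsMin (⊥ : P))

end ReplicateCarrier

/-- The graded poset `D_I^k(P)` for the interval `I = [a, b]` of ranks, where
`1 ≤ a ≤ b ≤ rank P - 1`: every element with rank in `I` is replaced by `k` copies. -/
noncomputable def replicate (P : GradedPoset) (a b : ℕ) (k : ℕ+) : GradedPoset where
  carrier := ReplicateCarrier P a b k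

/-- Apply `D_I^k` to `P`, one after the other, for all the intervals `I = [a, b]` with
`(a, b) ∈ 𝓘` (the order does not matter). -/
noncomputable def replicateSystem (P : GradedPoset) (𝓘 : Finset (ℕ × ℕ)) (k : ℕ+) :
    GradedPoset :=
  𝓘.toList.foldl (fun Q I => Q.replicate I.1 I.2 k) P

/-- The horizontal double of a graded poset of rank `n + 1`: apply `D_I^2` for
`I = [1, 1], …, [n, n]`. -/
noncomputable def horizontalDouble (P : GradedPoset) (n : ℕ) : GradedPoset :=
  P.replicateSystem ((Finset.Icc 1 n).image fun i => (i, i)) 2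

/-- The chain of rank `n + 1`, with `n + 2` elements. -/
def chain (n : ℕ) : GradedPoset where
  carrier := Fin (n + 2)
  instGrade := GradeMinOrder.finToNat (n + 2)

end GradedPoset

/-- The space `ℝ ^ (2 ^ n)` of real vectors indexed by the subsets of `[1, n]`. -/
abbrev FlagSpace (n : ℕ) : Type := (Finset.Icc 1 n).powerset → ℝ

/-- The flag `f`-vector of a graded poset of rank `n + 1`. -/
noncomputable def flagVector (n : ℕ) (P : GradedPoset) : FlagSpace n :=
  fun S => (P.flagNumber S : ℝ)

/-- The closed cone of flag `f`-vectors of Eulerian posets of rank `n + 1`. -/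
noncomputable def eulerianCone (n : ℕ) : PointedCone ℝ (FlagSpace n) :=
  (PointedCone.hull ℝ
    {v | ∃ P : GradedPoset, P.rank = n + 1 ∧ P.IsEulerian ∧ v = flagVector n P}).closure

/-- `R` is an extreme ray of the cone `C`: a face of `C` that is a ray. -/
def IsExtremeRay {E : Type*} [AddCommGroup E] [Module ℝ E] (C R : PointedCone ℝ E) : Prop :=
  R.IsFaceOf C ∧ ∃ v : E, v ≠ 0 ∧ R = PointedCone.hull ℝ {v}

/-- `F` is a facet of the cone `C`: a face whose dimension is one less than that of `C`. -/
def IsFacet {E : Type*} [AddCommGroup E] [Module ℝ E] (C F : PointedCone ℝ E) : Prop :=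
  F.IsFaceOf C ∧ Module.finrank ℝ (Submodule.span ℝ (F : Set E)) + 1 =
    Module.finrank ℝ (Submodule.span ℝ (C : Set E))

/-- An interval system on `[1, n]`: a set of nonempty subintervals of `[1, n]`, none of which is
contained in another; the pair `(a, b)` stands for `[a, b]`. -/
def IsIntervalSystem (n : ℕ) (𝓘 : Finset (ℕ × ℕ)) : Prop :=
  (∀ I ∈ 𝓘, 1 ≤ I.1 ∧ I.1 ≤ I.2 ∧ I.2 ≤ n) ∧
  ∀ I ∈ 𝓘, ∀ J ∈ 𝓘, I ≠ J → ¬ Finset.Icc I.1 I.2 ⊆ Finset.Icc J.1 J.2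

/-- An interval system is even if any two of its intervals (equal ones included) meet in an even
number of elements. -/
def IsEvenIntervalSystem (n : ℕ) (𝓘 : Finset (ℕ × ℕ)) : Prop :=
  IsIntervalSystem n 𝓘 ∧
  ∀ I ∈ 𝓘, ∀ J ∈ 𝓘, Even (Finset.Icc I.1 I.2 ∩ Finset.Icc J.1 J.2).card

/-- The poset `P(n, 𝓘, N)`: apply `D_I^N` for all `I ∈ 𝓘` to the chain of rank `n + 1`. -/
noncomputable def intervalPoset (n : ℕ) (𝓘 : Finset (ℕ × ℕ)) (N : ℕ+) : GradedPoset :=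
  (GradedPoset.chain n).replicateSystem 𝓘 N

/-- The normalized flag vector `f_S(D P(n, 𝓘, N)) / N ^ |𝓘|` of the doubled poset. -/
noncomputable def normalizedDoubleVector (n : ℕ) (𝓘 : Finset (ℕ × ℕ)) (N : ℕ+) : FlagSpace n :=
  fun S => flagVector n ((intervalPoset n 𝓘 N).horizontalDouble n) S / ((N : ℕ) : ℝ) ^ 𝓘.card

/-- The flag vector of the doubled limit poset `D P(n, 𝓘)`. -/
noncomputable def doubledLimitVector (n : ℕ) (𝓘 : Finset (ℕ × ℕ)) : FlagSpace n :=
  fun S => limUnder atTop fun N : ℕ+ => normalizedDoubleVector n 𝓘 N S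

/-- The entry `L_S` of the flag `L`-vector, as a linear form on flag vectors. -/
noncomputable def LForm (n : ℕ) (S : Finset ℕ) : FlagSpace n →ₗ[ℝ] ℝ :=
  (-1 : ℝ) ^ (n - S.card) •
    ∑ T : (Finset.Icc 1 n).powerset with Finset.Icc 1 n \ S ⊆ T.1,
      (-1 / 2 : ℝ) ^ T.1.card • LinearMap.proj T

/-- `[a, b]` is a maximal interval contained in `S`. -/
def IsMaximalInterval (S : Finset ℕ) (a b : ℕ) : Prop :=
  a ≤ b ∧ Finset.Icc a b ⊆ S ∧
  ∀ c d, c ≤ a → b ≤ d → Finset.Icc c d ⊆ S → c = a ∧ d = b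

/-- The conditions on the pair `M ⊆ V ⊆ [1, n]` under which
`(-1) ^ (|M| / 2) * ∑_{M ⊆ Q ⊆ V} L_Q ≥ 0` is one of the inequalities considered. -/
structure IsFacetPair (n : ℕ) (M V : Finset ℕ) : Prop where
  subset : V ⊆ Finset.Icc 1 n
  two_le : ∀ a b, IsMaximalInterval V a b → 2 ≤ (Finset.Icc a b).card
  le_three : ∀ a b, IsMaximalInterval (Finset.Icc 0 (n + 1) \ V) a b → (Finset.Icc a b).card ≤ 3
  subset' : M ⊆ V
  inter : ∀ a b, IsMaximalInterval V a b →
    M ∩ Finset.Icc a b = ∅ ∨ M ∩ Finset.Icc a b = Finset.Icc a (a + 1) ∨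
      M ∩ Finset.Icc a b = Finset.Icc (b - 1) b
  left : ∀ a b, IsMaximalInterval V a b → a ∉ M → a = 1 ∨ ∃ m ∈ M, m + 2 = a
  right : ∀ a b, IsMaximalInterval V a b → b ∉ M → b = n ∨ b + 2 ∈ M

/-- The linear form `(-1) ^ (|M| / 2) * ∑_{M ⊆ Q ⊆ V} L_Q`. -/
noncomputable def facetForm (n : ℕ) (M V : Finset ℕ) : FlagSpace n →ₗ[ℝ] ℝ :=
  (-1 : ℝ) ^ (M.card / 2) • ∑ Q ∈ V.powerset with M ⊆ Q, LForm n Q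

/-- The linear forms of the inequalities `∑_{Q ⊆ [1, n]} L_Q ≥ 0` and
`(-1) ^ (|M| / 2) * ∑_{M ⊆ Q ⊆ V} L_Q ≥ 0`, for all admissible pairs `(M, V)`. -/
def facetForms (n : ℕ) : Set (FlagSpace n →ₗ[ℝ] ℝ) :=
  {∑ Q ∈ (Finset.Icc 1 n).powerset, LForm n Q} ∪
    {φ | ∃ M V : Finset ℕ, IsFacetPair n M V ∧ φ = facetForm n M V}

/-!
# The closed cone of flag vectors of Eulerian posets of rank at most six

The cone is described twice, as the hull of the flag vectors of the doubled limit posets and as the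
solution set of the facet inequalities inside the span of these vectors.

*Inequalities.* By the transfer-matrix method a linear combination of flag numbers whose
coefficients are products of weights, one for each rank, is computed by one step per rank
(`weightedSum_flagVector`). Both `L_Q` and the sum of the `L_Q` over `M ⊆ Q ⊆ V` have this form
(`sum_LForm_apply`): a rank outside `V` must be used, a rank in `M` has the weights `1, -1 / 2`, and
the other ranks are skipped. In an Eulerian poset an interval of rank two has exactly two elements
of rank one, so of the two consecutive ranks of `M` in a gap only one matters, and it contributes
`1 - c / 2 ≤ 0`, where `c ≥ 2` counts the elements of that rank (`IsEulerian.transfer_sign`).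
If `Q` has a maximal interval of odd length then `L_Q = 0`: the chains through the corresponding gap
are counted by the Cayley transform of the zeta function `ζ`, which changes sign when `ζ` is
replaced by its inverse, that is, when it is conjugated by `(-1) ^ ρ`
(`IsEulerian.exists_halfInverse`).

*Rays.* Replacing the ranks in an interval by copies multiplies the number of elements of rank `t`
between two elements by a factor that depends on ranks only (`HasCounts.replicate`). This gives the
flag numbers of `D P(n, 𝓘, N)`, whose normalized limit is `2 ^ |S|` if `S` meets all intervals of
`𝓘` and `0` otherwise. For even `𝓘` it also gives the Eulerian relation, since intersections of
members of `𝓘` are even intervals and so have alternating sum zero (`sum_neg_one_pow_mul_pow`).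
By inclusion-exclusion these limits span the space `{L_Q = 0 for Q not even}`
(`mem_span_rayVector`).

*Comparison.* The facet forms take the values `0` and `1` on the rays (`facetForm_rayVector`). For
`n ≤ 5` enumeration shows that their supports are those of an iterated join of points and squares:
single rays, and edges of squares with vertices `{[s, s + 1]}`, `{[s, s + 3]}`,
`{[s + 2, s + 3]}`, `{[s, s + 1], [s + 2, s + 3]}`, where opposite vertices have equal sums. For
such a configuration the inequalities imply membership in the hull (`mem_hull_of_nonneg`), and the
extreme rays and facets can be read off from the incidences (`IsDualPair`).
-/

open Finset

/-! ### Weighted sums of flag numbers and the `L`-vector -/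

/-- The linear combination of the entries of a flag vector in which the coefficient of `f_T` is
the product over `j ∈ [1, n]` of a weight `β j` (if `j ∈ T`) or `α j` (if `j ∉ T`). -/
noncomputable def weightedSum (n : ℕ) (α β : ℕ → ℝ) (v : FlagSpace n) : ℝ :=
  ∑ T : (Icc 1 n).powerset, (∏ j ∈ Icc 1 n, if j ∈ T.1 then β j else α j) * v T

theorem LForm_apply {n : ℕ} {Q : Finset ℕ} (hQ : Q ⊆ Icc 1 n) (v : FlagSpace n) :
    LForm n Q v = ∑ T : (Icc 1 n).powerset, (∏ j ∈ Icc 1 n,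
      if j ∈ Q then (if j ∈ T.1 then -1 / 2 else 1) else if j ∈ T.1 then 1 / 2 else 0) * v T := by
  have hcard : n - Q.card = (Icc 1 n \ Q).card := by
    rw [card_sdiff_of_subset hQ, Nat.card_Icc, Nat.add_sub_cancel]
  simp only [LForm, LinearMap.smul_apply, LinearMap.sum_apply, LinearMap.proj_apply, smul_eq_mul,
    hcard]
  rw [mul_sum, sum_filter]
  refine sum_congr rfl fun T _ => ?_
  have hT := mem_powerset.1 T.2
  rw [← prod_sdiff hQ]
  have h1 : (∏ j ∈ Icc 1 n \ Q, if j ∈ Q then (if j ∈ T.1 then (-1 / 2 : ℝ) else 1)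
      else if j ∈ T.1 then 1 / 2 else 0) =
      if Icc 1 n \ Q ⊆ T.1 then (1 / 2 : ℝ) ^ (Icc 1 n \ Q).card else 0 := by
    split_ifs with h
    · rw [← prod_const]
      exact prod_congr rfl fun j hj => by
        rw [if_neg (Finset.mem_sdiff.1 hj).2, if_pos (h hj)]
    · obtain ⟨j, hj, hjT⟩ := not_subset.1 h
      exact prod_eq_zero hj (by rw [if_neg (Finset.mem_sdiff.1 hj).2, if_neg hjT])
  have h2 : (∏ j ∈ Q, if j ∈ Q then (if j ∈ T.1 then (-1 / 2 : ℝ) else 1)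
      else if j ∈ T.1 then 1 / 2 else 0) = (-1 / 2) ^ (Q ∩ T.1).card := by
    rw [← prod_const, ← prod_ite_mem]
    exact prod_congr rfl fun j hj => by rw [if_pos hj]
  rw [h1, h2]
  split_ifs with h
  · have h3 : T.1.card = (Icc 1 n \ Q).card + (Q ∩ T.1).card := by
      rw [← card_union_of_disjoint]
      · congr 1
        ext j
        have := @hT j
        have := @h j
        simp only [mem_union, Finset.mem_sdiff, mem_inter] at *
        tauto
      · exact disjoint_left.2 fun j hj hj' => (Finset.mem_sdiff.1 hj).2 (mem_inter.1 hj').1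
    rw [h3, pow_add, ← mul_assoc, ← mul_assoc, ← mul_pow]
    norm_num
  · simp

/-- Summing `L_Q` over `M ⊆ Q ⊆ V` multiplies out to one weighted sum: the weights of `j ∈ V \ M`
for `j ∈ Q` and for `j ∉ Q` add up to `1` if `j ∉ T` and cancel if `j ∈ T`. -/
theorem sum_LForm_apply {n : ℕ} {M V : Finset ℕ} (hM : M ⊆ V) (hV : V ⊆ Icc 1 n)
    (v : FlagSpace n) : ∑ Q ∈ V.powerset with M ⊆ Q, LForm n Q v =
      weightedSum n (fun j => if j ∈ V then 1 else 0)
        (fun j => if j ∈ M then -1 / 2 else if j ∈ V then 0 else 1 / 2) v := by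
  have h1 : ∑ Q ∈ V.powerset with M ⊆ Q, LForm n Q v =
      ∑ Q ∈ (Icc 1 n).powerset, if M ⊆ Q ∧ Q ⊆ V then LForm n Q v else 0 := by
    rw [← sum_filter]
    refine sum_congr ?_ fun _ _ => rfl
    ext Q
    simp only [mem_filter, mem_powerset]
    exact ⟨fun h => ⟨h.1.trans hV, h.2, h.1⟩, fun h => ⟨h.2.2, h.2.1⟩⟩
  have h2 : ∀ Q ∈ (Icc 1 n).powerset, (if M ⊆ Q ∧ Q ⊆ V then LForm n Q v else 0) =
      ∑ T : (Icc 1 n).powerset,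
        ((∏ j ∈ Q, if j ∈ V then (if j ∈ T.1 then (-1 / 2 : ℝ) else 1) else 0) *
        ∏ j ∈ Icc 1 n \ Q, if j ∈ M then 0 else if j ∈ T.1 then 1 / 2 else 0) * v T := by
    intro Q hQ
    have hQ' := mem_powerset.1 hQ
    split_ifs with h
    · rw [LForm_apply hQ']
      refine sum_congr rfl fun T _ => ?_
      rw [← prod_sdiff hQ', mul_comm (∏ j ∈ Icc 1 n \ Q, _)]
      congr 2
      · exact prod_congr rfl fun j hj => by rw [if_pos hj, if_pos (h.2 hj)]
      · exact prod_congr rfl fun j hj => by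
          rw [if_neg (Finset.mem_sdiff.1 hj).2, if_neg fun hjM => (Finset.mem_sdiff.1 hj).2 (h.1 hjM)]
    · refine (sum_eq_zero fun T _ => ?_).symm
      rw [not_and_or] at h
      rcases h with h | h
      · obtain ⟨j, hj, hjQ⟩ := not_subset.1 h
        rw [prod_eq_zero (s := Icc 1 n \ Q) (f := fun j => if j ∈ M then (0 : ℝ) else
          if j ∈ T.1 then 1 / 2 else 0) (Finset.mem_sdiff.2 ⟨hV (hM hj), hjQ⟩) (if_pos hj),
          mul_zero, zero_mul]
      · obtain ⟨j, hj, hjQ⟩ := not_subset.1 h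
        rw [prod_eq_zero hj (if_neg hjQ), zero_mul, zero_mul]
  rw [h1, sum_congr rfl h2, sum_comm, weightedSum]
  refine sum_congr rfl fun T _ => ?_
  rw [← sum_mul, ← prod_add]
  congr 1
  refine prod_congr rfl fun j _ => ?_
  have := @hM j
  by_cases h1 : j ∈ M <;> by_cases h2 : j ∈ V <;> by_cases h3 : j ∈ T.1 <;>
    (simp [h1, h2, h3] at this ⊢; try norm_num)

theorem facetForm_apply {n : ℕ} {M V : Finset ℕ} (hM : M ⊆ V) (hV : V ⊆ Icc 1 n)
    (v : FlagSpace n) : facetForm n M V v = (-1) ^ (M.card / 2) *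
      weightedSum n (fun j => if j ∈ V then 1 else 0)
        (fun j => if j ∈ M then -1 / 2 else if j ∈ V then 0 else 1 / 2) v := by
  rw [← sum_LForm_apply hM hV]
  simp [facetForm, LinearMap.sum_apply]

theorem LForm_eq_weightedSum {n : ℕ} {Q : Finset ℕ} (hQ : Q ⊆ Icc 1 n) (v : FlagSpace n) :
    LForm n Q v = weightedSum n (fun j => if j ∈ Q then 1 else 0)
      (fun j => if j ∈ Q then -1 / 2 else if j ∈ Q then 0 else 1 / 2) v := by
  rw [← sum_LForm_apply Subset.rfl hQ, sum_filter, sum_eq_single Q]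
  · simp
  · intro R hR hne
    exact if_neg fun h => hne ((mem_powerset.1 hR).antisymm h)
  · simp

/-- The `L`-vector determines the flag vector. -/
theorem sum_LForm_eq_apply {n : ℕ} (v : FlagSpace n) (T : (Icc 1 n).powerset) :
    ∑ Q ∈ (Icc 1 n \ T.1).powerset, LForm n Q v = (1 / 2) ^ T.1.card * v T := by
  have hT := mem_powerset.1 T.2
  have h := sum_LForm_apply (empty_subset (Icc 1 n \ T.1)) sdiff_subset v
  simp only [empty_subset, filter_true] at h
  rw [h, weightedSum, sum_eq_single T]
  · congr 1
    rw [← prod_sdiff hT, prod_eq_one, one_mul, ← prod_const]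
    · refine prod_congr rfl fun j hj => ?_
      simp [hj]
    · intro j hj
      have := Finset.mem_sdiff.1 hj
      simp [this.1, this.2]
  · intro R _ hne
    have hR := mem_powerset.1 R.2
    have : ∃ j ∈ Icc 1 n, ¬ (j ∈ R.1 ↔ j ∈ T.1) := by
      by_contra! hcon
      refine hne (Subtype.ext (ext fun j => ?_))
      exact ⟨fun hj => (hcon j (hR hj)).1 hj, fun hj => (hcon j (hT hj)).2 hj⟩
    obtain ⟨j, hj, hjRT⟩ := this
    rw [prod_eq_zero hj, zero_mul]
    by_cases h1 : j ∈ R.1 <;> by_cases h2 : j ∈ T.1 <;> simp [h1, h2, hj] at hjRT ⊢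
  · simp

/-! ### Counting chains -/

namespace GradedPoset

open scoped Classical

variable {P : GradedPoset}

theorem rk_lt_rk {x y : P} (h : x < y) : P.rk x < P.rk y := grade_strictMono h

theorem rk_le_rk {x y : P} (h : x ≤ y) : P.rk x ≤ P.rk y := grade_strictMono.monotone h

theorem rk_bot : P.rk ⊥ = 0 := by
  have h : IsMin (grade ℕ (⊥ : P)) := isMin_bot.grade ℕ
  exact h.eq_bot

/-- The chains with rank set `T` all of whose elements lie below `y`. -/
noncomputable def chainsBelow (T : Finset ℕ) (y : P) : Finset (Finset P) :=
  {c | IsChain (· ≤ ·) (c : Set P) ∧ c.image P.rk = T ∧ ∀ z ∈ c, z < y}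

theorem mem_chainsBelow {T : Finset ℕ} {y : P} {c : Finset P} : c ∈ chainsBelow T y ↔
    IsChain (· ≤ ·) (c : Set P) ∧ c.image P.rk = T ∧ ∀ z ∈ c, z < y := by
  simp [chainsBelow]

theorem flagNumber_eq_card_chainsBelow {n : ℕ} (hP : P.rank = n + 1) {S : Finset ℕ}
    (hS : S ⊆ Icc 1 n) : P.flagNumber S = (chainsBelow S (⊤ : P)).card := by
  rw [flagNumber, Nat.card_eq_fintype_card, Fintype.card_subtype, chainsBelow]
  congr 1
  ext c
  simp only [mem_filter, mem_univ, true_and]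
  refine ⟨fun h => ⟨h.1, h.2, fun z hz => lt_top_iff_ne_top.2 ?_⟩, fun h => ⟨h.1, h.2.1⟩⟩
  rintro rfl
  have := mem_Icc.1 (hS (h.2 ▸ mem_image_of_mem P.rk hz))
  have h' : P.rk ⊤ = n + 1 := hP
  omega

theorem card_chainsBelow_empty (y : P) : (chainsBelow ∅ y).card = 1 := by
  rw [card_eq_one]
  refine ⟨∅, ?_⟩
  ext c
  simp only [mem_chainsBelow, image_eq_empty, mem_singleton]
  exact ⟨fun h => h.2.1, fun h => by simp [h]⟩

/-- A nonempty chain is its largest element together with a chain below that. -/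
theorem card_chainsBelow_insert {T : Finset ℕ} {s : ℕ} (hs : ∀ t ∈ T, t < s) (y : P) :
    (chainsBelow (insert s T) y).card = ∑ z with z < y ∧ P.rk z = s, (chainsBelow T z).card := by
  rw [← card_sigma]
  symm
  refine card_nbij (fun p => insert p.1 p.2) ?_ ?_ ?_
  · rintro ⟨z, c⟩ h
    simp only [mem_coe, mem_sigma, mem_filter, mem_univ, true_and, mem_chainsBelow] at h ⊢
    obtain ⟨⟨hzy, hzs⟩, hc, hcT, hcz⟩ := h
    refine ⟨?_, ?_, ?_⟩
    · rw [coe_insert]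
      exact hc.insert fun b hb _ => Or.inr (hcz b hb).le
    · rw [image_insert, hzs, hcT]
    · intro w hw
      rcases mem_insert.1 hw with rfl | hw
      · exact hzy
      · exact (hcz w hw).trans hzy
  · rintro ⟨z, c⟩ h ⟨z', c'⟩ h' heq
    simp only [mem_coe, mem_sigma, mem_filter, mem_univ, true_and, mem_chainsBelow] at h h' heq
    obtain ⟨⟨hzy, hzs⟩, hc, hcT, hcz⟩ := h
    obtain ⟨⟨hzy', hzs'⟩, hc', hcT', hcz'⟩ := h'
    have hz : z = z' := by
      rcases mem_insert.1 (heq ▸ mem_insert_self z c) with h | h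
      · exact h
      · exact absurd (hs _ (hcT' ▸ mem_image_of_mem P.rk h)) (by omega)
    subst hz
    have : c = c' := by
      rw [← erase_insert (fun h => lt_irrefl _ (hcz z h)), heq,
        erase_insert (fun h => lt_irrefl _ (hcz' z h))]
    rw [this]
  · intro d hd
    simp only [mem_coe, mem_chainsBelow] at hd
    obtain ⟨hd, hdT, hdy⟩ := hd
    obtain ⟨z, hz, hzs⟩ := mem_image.1 (hdT ▸ mem_insert_self s T)
    have key : ∀ w ∈ d, w ≠ z → P.rk w ∈ T ∧ w < z := by
      intro w hw hwz
      have hne : P.rk w ≠ s := by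
        rcases hd.total hw hz with h | h
        · have := rk_lt_rk (lt_of_le_of_ne h hwz); omega
        · have := rk_lt_rk (lt_of_le_of_ne h hwz.symm); omega
      have hT : P.rk w ∈ T :=
        (mem_insert.1 (hdT ▸ mem_image_of_mem P.rk hw)).resolve_left hne
      refine ⟨hT, lt_of_le_of_ne ?_ hwz⟩
      refine (hd.total hw hz).resolve_right fun h => ?_
      have := rk_le_rk h
      have := hs _ hT
      omega
    refine ⟨⟨z, d.erase z⟩, ?_, insert_erase hz⟩
    simp only [mem_coe, mem_sigma, mem_filter, mem_univ, true_and, mem_chainsBelow]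
    refine ⟨⟨hdy z hz, hzs⟩, hd.mono (by simp), ?_, fun w hw =>
      (key w (mem_of_mem_erase hw) (ne_of_mem_erase hw)).2⟩
    ext t
    simp only [mem_image, mem_erase]
    constructor
    · rintro ⟨w, ⟨hwz, hw⟩, rfl⟩
      exact (key w hw hwz).1
    · intro ht
      obtain ⟨w, hw, rfl⟩ := mem_image.1 (hdT ▸ mem_insert_of_mem ht)
      refine ⟨w, ⟨?_, hw⟩, rfl⟩
      rintro rfl
      exact absurd (hs _ ht) (by omega)

/-- One step of the transfer-matrix method: a chain whose largest element carries the weight `u`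
either skips the rank `j`, with factor `a`, or is extended by an element of rank `j`, with
factor `b`. -/
noncomputable def stepAt (j : ℕ) (a b : ℝ) (u : P → ℝ) : P → ℝ := fun y =>
  a * u y + if P.rk y = j then b * ∑ z with z < y, u z else 0

/-- The result of the steps at the ranks `1, …, m`, applied to the chain `{⊥}`. -/
noncomputable def transfer (P : GradedPoset) (α β : ℕ → ℝ) : ℕ → P → ℝ
  | 0 => fun y => if y = ⊥ then 1 else 0
  | m + 1 => stepAt (m + 1) (α (m + 1)) (β (m + 1)) (transfer P α β m)

theorem sum_transfer (α β : ℕ → ℝ) (m : ℕ) (y : P) (hy : m < P.rk y) :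
    ∑ z with z < y, P.transfer α β m z = ∑ T ∈ (Icc 1 m).powerset,
      (∏ j ∈ Icc 1 m, if j ∈ T then β j else α j) * (chainsBelow T y).card := by
  induction m generalizing y with
  | zero =>
    have : ⊥ < y := bot_lt_iff_ne_bot.2 fun h => by rw [h, rk_bot] at hy; omega
    simp [transfer, card_chainsBelow_empty, sum_ite_eq', this]
  | succ m ih =>
    have hI : Icc 1 (m + 1) = insert (m + 1) (Icc 1 m) := by
      ext j; simp only [mem_insert, mem_Icc]; omega
    have hm : m + 1 ∉ Icc 1 m := by simp
    rw [hI, sum_powerset_insert hm]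
    simp only [transfer, stepAt]
    rw [sum_add_distrib, ← mul_sum, ih y (by omega), ← sum_filter, filter_filter, mul_sum]
    congr 1
    · refine sum_congr rfl fun T hT => ?_
      rw [prod_insert hm, if_neg fun h => hm (mem_powerset.1 hT h), mul_assoc]
    · have h1 : ∀ z ∈ ({z | z < y ∧ P.rk z = m + 1} : Finset P),
          β (m + 1) * ∑ w with w < z, P.transfer α β m w = ∑ T ∈ (Icc 1 m).powerset,
          β (m + 1) * ((∏ j ∈ Icc 1 m, if j ∈ T then β j else α j) *
            (chainsBelow T z).card) := by
        intro z hz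
        rw [ih z (by have := (mem_filter.1 hz).2.2; omega), mul_sum]
      rw [sum_congr rfl h1, sum_comm]
      refine sum_congr rfl fun T hT => ?_
      have hT' := mem_powerset.1 hT
      rw [card_chainsBelow_insert fun t ht => by have := mem_Icc.1 (hT' ht); omega,
        prod_insert hm, if_pos (mem_insert_self _ _), Nat.cast_sum, mul_sum]
      refine sum_congr rfl fun z _ => ?_
      rw [← mul_assoc]
      congr 2
      refine prod_congr rfl fun j hj => ?_
      have : j ≠ m + 1 := fun h => hm (h ▸ hj)
      simp [this]

theorem weightedSum_flagVector {n : ℕ} (hP : P.rank = n + 1) (α β : ℕ → ℝ) :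
    weightedSum n α β (flagVector n P) = ∑ z with z < (⊤ : P), P.transfer α β n z := by
  rw [sum_transfer α β n ⊤ (by have h : P.rk ⊤ = n + 1 := hP; omega), weightedSum,
    ← sum_coe_sort (Icc 1 n).powerset]
  refine sum_congr rfl fun T _ => ?_
  rw [← flagNumber_eq_card_chainsBelow hP (mem_powerset.1 T.2), flagVector]

end GradedPoset

/-! ### Eulerian posets -/

namespace GradedPoset

open scoped Classical

variable {P : GradedPoset}

/-- `P` is Eulerian iff every nontrivial interval has as many elements of even rank as elements of
odd rank. -/
theorem isEulerian_iff : P.IsEulerian ↔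
    ∀ x y : P, x < y → ∑ z with x ≤ z ∧ z ≤ y, (-1 : ℤ) ^ P.rk z = 0 := by
  let _ : LocallyFiniteOrder P := Fintype.toLocallyFiniteOrder
  have hIcc : ∀ x y : P, Icc x y = ({z | x ≤ z ∧ z ≤ y} : Finset P) := fun x y => by
    ext; simp
  have hsign : ∀ x z : P, x ≤ z →
      (-1 : ℤ) ^ (P.rk z - P.rk x) = (-1) ^ P.rk x * (-1) ^ P.rk z := fun x z h => by
    have h1 := rk_le_rk h
    have h2 : P.rk x + P.rk z = (P.rk z - P.rk x) + 2 * P.rk x := by omega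
    rw [← pow_add, h2, pow_add, pow_mul]
    simp
  constructor
  · intro hP x y hxy
    have h := IncidenceAlgebra.sum_Icc_mu_right (𝕜 := ℤ) x y
    rw [if_neg hxy.ne, hIcc] at h
    have h' : ∑ z with x ≤ z ∧ z ≤ y, (-1 : ℤ) ^ P.rk x * (-1) ^ P.rk z = 0 := by
      rw [← h]
      refine sum_congr rfl fun z hz => ?_
      rw [← hsign x z (mem_filter.1 hz).2.1]
      exact (hP x z (mem_filter.1 hz).2.1).symm
    rw [← mul_sum] at h'
    exact (mul_eq_zero.1 h').resolve_left (pow_ne_zero _ (by norm_num))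
  · intro h x y hxy
    change IncidenceAlgebra.mu ℤ x y = _
    induction y using WellFoundedLT.induction with
    | ind y ih =>
      rcases hxy.eq_or_lt with rfl | hlt
      · simp
      · have h1 := IncidenceAlgebra.sum_Icc_mu_right (𝕜 := ℤ) x y
        rw [if_neg hlt.ne, Icc_eq_cons_Ico hxy, sum_cons] at h1
        have h2 := h x y hlt
        rw [← hIcc, Icc_eq_cons_Ico hxy, sum_cons] at h2
        have h3 : ∑ z ∈ Ico x y, IncidenceAlgebra.mu ℤ x z =
            (-1) ^ P.rk x * ∑ z ∈ Ico x y, (-1) ^ P.rk z := by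
          rw [mul_sum]
          refine sum_congr rfl fun z hz => ?_
          have hz' := mem_Ico.1 hz
          rw [ih z hz'.2 hz'.1, hsign x z hz'.1]
        rw [h3] at h1
        rw [hsign x y hxy]
        linear_combination h1 - (-1) ^ P.rk x * h2

theorem exists_rk_eq {x y : P} (hxy : x ≤ y) {t : ℕ} (hx : P.rk x ≤ t) (hy : t ≤ P.rk y) :
    ∃ z, x ≤ z ∧ z ≤ y ∧ P.rk z = t := by
  obtain ⟨d, hd⟩ : ∃ d, t = P.rk x + d := ⟨t - P.rk x, by omega⟩
  induction d generalizing x with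
  | zero => exact ⟨x, le_rfl, hxy, by omega⟩
  | succ d ih =>
    have hlt : x < y := lt_of_le_of_ne hxy fun h => by subst h; omega
    obtain ⟨w, hxw, hwy⟩ := exists_covBy_le_of_lt hlt
    have hw : P.rk x + 1 = P.rk w := Nat.covBy_iff_add_one_eq.1 (hxw.grade ℕ)
    obtain ⟨z, hz⟩ := ih hwy (by omega) (by omega)
    exact ⟨z, hxw.le.trans hz.1, hz.2⟩

/-- The number of elements of rank `t` strictly between `x` and `y`. -/
noncomputable def between (x y : P) (t : ℕ) : ℕ := #{z : P | x < z ∧ z < y ∧ P.rk z = t}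

theorem IsEulerian.between_eq_two (hP : P.IsEulerian) {x y : P} (hxy : x < y)
    (h : P.rk y = P.rk x + 2) : between x y (P.rk x + 1) = 2 := by
  have h0 := isEulerian_iff.1 hP x y hxy
  have hset : ({z | x ≤ z ∧ z ≤ y} : Finset P) =
      insert x (insert y ({z | x < z ∧ z < y ∧ P.rk z = P.rk x + 1} : Finset P)) := by
    ext z
    simp only [mem_filter, mem_univ, true_and, mem_insert]
    constructor
    · rintro ⟨hxz, hzy⟩
      rcases hxz.eq_or_lt with rfl | hxz
      · simp
      rcases hzy.eq_or_lt with rfl | hzy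
      · simp
      have := rk_lt_rk hxz
      have := rk_lt_rk hzy
      exact Or.inr (Or.inr ⟨hxz, hzy, by omega⟩)
    · rintro (rfl | rfl | hz)
      · exact ⟨le_rfl, hxy.le⟩
      · exact ⟨hxy.le, le_rfl⟩
      · exact ⟨hz.1.le, hz.2.1.le⟩
  rw [hset, sum_insert (by simp [hxy.ne]), sum_insert (by simp)] at h0
  rw [sum_congr rfl (g := fun _ => (-1 : ℤ) ^ (P.rk x + 1))
    fun z hz => by rw [(mem_filter.1 hz).2.2.2], sum_const, h] at h0
  have h1 : (-1 : ℤ) ^ P.rk x * (2 - (between x y (P.rk x + 1) : ℤ)) = 0 := by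
    rw [← h0, between]
    simp only [pow_add, nsmul_eq_mul]
    ring
  have h2 := (mul_eq_zero.1 h1).resolve_left (pow_ne_zero _ (by norm_num))
  omega

theorem IsEulerian.two_le_between (hP : P.IsEulerian) {x y : P} (hxy : x < y) {t : ℕ}
    (hx : P.rk x < t) (hy : t < P.rk y) : 2 ≤ between x y t := by
  obtain ⟨w, hxw, hwy, hw⟩ := exists_rk_eq hxy.le (t := t - 1) (by omega) (by omega)
  obtain ⟨w', hww', hwy', hw'⟩ := exists_rk_eq hwy (t := t + 1) (by omega) (by omega)
  have h := hP.between_eq_two (lt_of_le_of_ne hww' fun h => by subst h; omega) (by omega)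
  rw [← h, show P.rk w + 1 = t by omega]
  refine card_le_card fun z hz => ?_
  simp only [mem_filter, mem_univ, true_and] at hz ⊢
  exact ⟨hxw.trans_lt hz.1, hz.2.1.trans_le hwy', hz.2.2⟩

/-! ### The inequalities -/

/-- Inserting a step with the weights `1, -1 / 2` at the rank `j` multiplies the contribution of
`w` by `1 - c / 2`, where `c` counts the elements of rank `j` between `w` and `y`. -/
theorem sum_lt_stepAt (j : ℕ) (u : P → ℝ) (y : P) :
    ∑ z with z < y, stepAt j 1 (-1 / 2) u z =
      ∑ w with w < y, u w * (1 - between w y j / 2) := by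
  have h : ∑ z with z < y ∧ P.rk z = j, ∑ w with w < z, u w =
      ∑ w with w < y, u w * between w y j := by
    have h1 : ∀ w ∈ ({w | w < y} : Finset P), u w * between w y j =
        ∑ z with w < z ∧ z < y ∧ P.rk z = j, u w := fun w _ => by
      rw [sum_const, between, nsmul_eq_mul, mul_comm]
    rw [sum_congr rfl h1]
    refine sum_comm' fun z w => ?_
    simp only [mem_filter, mem_univ, true_and]
    exact ⟨fun h => ⟨⟨h.2, h.1⟩, h.2.trans h.1.1⟩, fun h => ⟨h.1.2, h.1.1⟩⟩
  simp only [stepAt, one_mul]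
  rw [sum_add_distrib, ← sum_filter, filter_filter, ← mul_sum, h, mul_sum, ← sum_add_distrib]
  exact sum_congr rfl fun w _ => by ring

/-- `u` vanishes outside the elements of rank `i`. -/
def SupportedOn (i : ℕ) (u : P → ℝ) : Prop := ∀ z, P.rk z ≠ i → u z = 0

theorem supportedOn_stepAt (j : ℕ) (b : ℝ) (u : P → ℝ) : SupportedOn j (stepAt j 0 b u) :=
  fun z hz => by simp [stepAt, hz]

theorem transfer_succ_of_eq (α β : ℕ → ℝ) (m : ℕ) {a b : ℝ} (ha : α (m + 1) = a)
    (hb : β (m + 1) = b) :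
    P.transfer α β (m + 1) = stepAt (m + 1) a b (P.transfer α β m) := by
  rw [transfer, ha, hb]

theorem supportedOn_transfer (α β : ℕ → ℝ) (m : ℕ) (hα : α m = 0 ∨ m = 0) :
    SupportedOn m (P.transfer α β m) := by
  cases m with
  | zero =>
    intro z hz
    simp only [transfer]
    exact if_neg fun h => hz (by rw [h, rk_bot])
  | succ m =>
    rw [transfer_succ_of_eq α β m (hα.resolve_right (by omega)) rfl]
    exact supportedOn_stepAt _ _ _

theorem transfer_eq_of_trivial (α β : ℕ → ℝ) {i k : ℕ} (hik : i ≤ k)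
    (hα : ∀ j, i < j → j ≤ k → α j = 1 ∧ β j = 0) :
    P.transfer α β k = P.transfer α β i := by
  induction k, hik using Nat.le_induction with
  | base => rfl
  | succ k hk ih =>
    obtain ⟨h1, h2⟩ := hα (k + 1) (by omega) le_rfl
    rw [transfer_succ_of_eq α β k h1 h2, ih fun j hj hj' => hα j hj (by omega)]
    funext z
    simp [stepAt]

/-- A gap of an Eulerian poset in which one rank is used with the weights `1, -1 / 2` reverses
signs, because there are at least two elements of every rank in between. -/
theorem IsEulerian.sum_lt_mul_nonpos (hP : P.IsEulerian) {i j : ℕ} {u : P → ℝ} {y : P}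
    (hu : SupportedOn i u) (hij : i < j) (hj : j < P.rk y) {ε : ℝ} (hε : ∀ z, 0 ≤ ε * u z) :
    0 ≤ -ε * ∑ w with w < y, u w * (1 - between w y j / 2) := by
  rw [mul_sum]
  refine sum_nonneg fun w hw => ?_
  by_cases hwi : P.rk w = i
  · have h1 := hP.two_le_between (mem_filter.1 hw).2 (by omega) hj
    have h2 : (2 : ℝ) ≤ between w y j := by exact_mod_cast h1
    have h3 := mul_nonneg (hε w) (show (0 : ℝ) ≤ between w y j / 2 - 1 by linarith)
    linarith
  · simp [hu w hwi]

/-- Two consecutive steps with the weights `1, -1 / 2` right after a rank that has to be used act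
as the first one alone, because intervals of rank two have two elements of rank one. -/
theorem IsEulerian.stepAt_stepAt_left (hP : P.IsEulerian) {i : ℕ} {u : P → ℝ}
    (hu : SupportedOn i u) :
    stepAt (i + 2) 1 (-1 / 2) (stepAt (i + 1) 1 (-1 / 2) u) = stepAt (i + 1) 1 (-1 / 2) u := by
  funext y
  rw [stepAt, one_mul, add_eq_left]
  split_ifs with hy
  · rw [sum_lt_stepAt, sum_eq_zero, mul_zero]
    intro w hw
    by_cases hwi : P.rk w = i
    · have h := hP.between_eq_two (mem_filter.1 hw).2 (by omega)
      rw [hwi] at h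
      simp [h]
    · simp [hu w hwi]
  · rfl

/-- Two consecutive steps with the weights `1, -1 / 2` right before a rank that has to be used act
as the second one alone. -/
theorem IsEulerian.sum_lt_stepAt_stepAt_right (hP : P.IsEulerian) {j : ℕ} {u : P → ℝ} {y : P}
    (hy : P.rk y = j + 2) :
    ∑ z with z < y, stepAt (j + 1) 1 (-1 / 2) (stepAt j 1 (-1 / 2) u) z =
      ∑ w with w < y, u w * (1 - between w y (j + 1) / 2) := by
  rw [sum_lt_stepAt]
  refine sum_congr rfl fun w hw => ?_
  by_cases hwj : P.rk w = j
  · have h := hP.between_eq_two (mem_filter.1 hw).2 (by omega)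
    rw [hwj] at h
    simp [h]
  · simp [stepAt, hwj]

end GradedPoset

theorem isMaximalInterval_iff {S : Finset ℕ} {a b : ℕ} : IsMaximalInterval S a b ↔
    a ≤ b ∧ Icc a b ⊆ S ∧ (a = 0 ∨ a - 1 ∉ S) ∧ b + 1 ∉ S := by
  constructor
  · rintro ⟨h1, h2, h3⟩
    refine ⟨h1, h2, ?_, fun hb => ?_⟩
    · by_contra! h
      have := (h3 (a - 1) b (by omega) le_rfl ?_).1
      · omega
      · intro x hx
        rw [mem_Icc] at hx
        rcases eq_or_ne x (a - 1) with rfl | hne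
        · exact h.2
        · exact h2 (mem_Icc.2 (by omega))
    · have := (h3 a (b + 1) le_rfl (by omega) ?_).2
      · omega
      · intro x hx
        rw [mem_Icc] at hx
        rcases eq_or_ne x (b + 1) with rfl | hne
        · exact hb
        · exact h2 (mem_Icc.2 (by omega))
  · rintro ⟨h1, h2, h3, h4⟩
    refine ⟨h1, h2, fun c d hc hd hS => ⟨?_, ?_⟩⟩
    · by_contra hne
      exact h3.elim (by omega) fun h => h (hS (mem_Icc.2 (by omega)))
    · by_contra hne
      exact h4 (hS (mem_Icc.2 (by omega)))

namespace GradedPoset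

open scoped Classical

variable {P : GradedPoset}

/-- The inequality of an admissible pair, one gap at a time: at every rank `m ∉ V` the transferred
vector has the sign `(-1) ^ (|M ∩ [1, m]| / 2)`. -/
theorem IsEulerian.transfer_sign (hP : P.IsEulerian) {n : ℕ} {M V : Finset ℕ}
    (h : IsFacetPair n M V) (m : ℕ) (hm : m ∉ V) (y : P) :
    0 ≤ (-1) ^ ((M ∩ Icc 1 m).card / 2) * P.transfer (fun j => if j ∈ V then 1 else 0)
      (fun j => if j ∈ M then -1 / 2 else if j ∈ V then 0 else 1 / 2) m y := by
  set α : ℕ → ℝ := fun j => if j ∈ V then 1 else 0 with hα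
  set β : ℕ → ℝ := fun j => if j ∈ M then -1 / 2 else if j ∈ V then 0 else 1 / 2 with hβ
  have hMV := h.subset'
  have h0V : 0 ∉ V := fun h0 => by have := mem_Icc.1 (h.subset h0); omega
  induction m using Nat.strong_induction_on generalizing y with
  | h m ih =>
    rcases Nat.eq_zero_or_pos m with rfl | hm0
    · simp only [transfer, Icc_eq_empty_of_lt zero_lt_one, inter_empty, card_empty,
        Nat.zero_div, pow_zero, one_mul]
      split_ifs <;> norm_num
    -- `i` is the last rank before `m` that is not in `V`
    obtain ⟨i, hiV, him, hi⟩ : ∃ i, i ∉ V ∧ i < m ∧ ∀ j, i < j → j < m → j ∈ V := by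
      have hne : ({j ∈ range m | j ∉ V} : Finset ℕ).Nonempty :=
        ⟨0, by simp [hm0, h0V]⟩
      have hmax := max'_mem _ hne
      rw [mem_filter, mem_range] at hmax
      refine ⟨_, hmax.2, hmax.1, fun j hj hjm => ?_⟩
      by_contra hjV
      exact absurd (le_max' _ j (by simp [hjm, hjV])) (not_le.2 hj)
    have hsupp : SupportedOn i (P.transfer α β i) := supportedOn_transfer α β i (by simp [hα, hiV])
    have hmM : m ∉ M := fun h' => hm (hMV h')
    obtain ⟨k, rfl⟩ : ∃ k, m = k + 1 := ⟨m - 1, by omega⟩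
    have hstep : ∀ u : P → ℝ, ∀ ε : ℝ, P.transfer α β k = u → (P.rk y = k + 1 →
        0 ≤ ε * ∑ z with z < y, u z) → 0 ≤ ε * P.transfer α β (k + 1) y := by
      intro u ε hu h1
      rw [transfer_succ_of_eq α β k (a := 0) (b := 1 / 2) (by simp [hα, hm])
        (by simp [hβ, hm, hmM]), hu, stepAt]
      split_ifs with hy
      · have := h1 hy
        linarith
      · simp
    -- the two cases for the part of `M` in the gap: nothing, or two elements
    have hMi : M ∩ Icc (i + 1) k = ∅ → M ∩ Icc 1 (k + 1) = M ∩ Icc 1 i := by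
      intro hM
      ext j
      simp only [mem_inter, mem_Icc, and_congr_right_iff]
      intro hj
      have h1 : j ≠ k + 1 := fun hjk => hmM (hjk ▸ hj)
      have h2 : ¬ (i + 1 ≤ j ∧ j ≤ k) := fun hjk =>
        notMem_empty j (hM ▸ mem_inter.2 ⟨hj, mem_Icc.2 hjk⟩)
      omega
    have hsum : ∀ y : P, 0 ≤ (-1) ^ ((M ∩ Icc 1 i).card / 2) *
        ∑ z with z < y, P.transfer α β i z := fun y => by
      rw [mul_sum]
      exact sum_nonneg fun z _ => ih i him hiV z
    rcases Nat.lt_or_ge i k with hik | hik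
    swap
    · obtain rfl : i = k := by omega
      rw [hMi (by simp)]
      exact hstep _ _ rfl fun _ => hsum y
    have hI : IsMaximalInterval V (i + 1) k := isMaximalInterval_iff.2
      ⟨hik, fun j hj => hi j (by have := mem_Icc.1 hj; omega) (by have := mem_Icc.1 hj; omega),
        Or.inr hiV, hm⟩
    have hik2 : i + 2 ≤ k := by
      have := h.two_le _ _ hI
      rw [Nat.card_Icc] at this
      omega
    have hsign : ∀ c, i < c → c + 1 ≤ k → M ∩ Icc (i + 1) k = Icc c (c + 1) →
        (-1 : ℝ) ^ ((M ∩ Icc 1 (k + 1)).card / 2) = -(-1) ^ ((M ∩ Icc 1 i).card / 2) := by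
      intro c hc hck hM
      have h1 : M ∩ Icc 1 (k + 1) = (M ∩ Icc 1 i) ∪ Icc c (c + 1) := by
        rw [← hM]
        ext j
        simp only [mem_inter, mem_Icc, mem_union]
        have h1 : j ∈ M → j ≠ k + 1 := fun hj hjk => hmM (hjk ▸ hj)
        constructor
        · rintro ⟨hj, hj'⟩
          have := h1 hj
          rcases Nat.lt_or_ge i j with hij | hij
          · exact Or.inr ⟨hj, by omega⟩
          · exact Or.inl ⟨hj, by omega⟩
        · rintro (⟨hj, hj'⟩ | ⟨hj, hj'⟩) <;> exact ⟨hj, by omega⟩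
      rw [h1, card_union_of_disjoint, Nat.card_Icc, show c + 1 + 1 - c = 2 by omega,
        Nat.add_div_right _ two_pos, pow_succ]
      · ring
      · refine disjoint_left.2 fun j hj hj' => ?_
        have := mem_Icc.1 (mem_inter.1 hj).2
        have := mem_Icc.1 hj'
        omega
    -- outside of `M`, the steps inside the gap are trivial
    have htriv : ∀ a b, i ≤ a → a ≤ b → b ≤ k → (∀ j, a < j → j ≤ b → j ∉ M) →
        P.transfer α β b = P.transfer α β a := by
      intro a b hia hab hbk hM
      refine transfer_eq_of_trivial α β hab fun j hj hjb => ?_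
      have hjV := hi j (by omega) (by omega)
      simp [hα, hβ, hjV, hM j hj hjb]
    have hone : ∀ j, i < j + 1 → j + 1 ≤ k → j + 1 ∈ M →
        P.transfer α β (j + 1) = stepAt (j + 1) 1 (-1 / 2) (P.transfer α β j) := by
      intro j hij hjk hjM
      exact transfer_succ_of_eq α β j (by simp [hα, hMV hjM]) (by simp [hβ, hjM])
    have hmem : ∀ {c}, M ∩ Icc (i + 1) k = Icc c (c + 1) → ∀ j, i < j → j ≤ k →
        (j ∈ M ↔ j = c ∨ j = c + 1) := by
      intro c hM j hij hjk
      have h1 : j ∈ M ∩ Icc (i + 1) k ↔ j ∈ Icc c (c + 1) := by rw [hM]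
      simp only [mem_inter, mem_Icc] at h1
      constructor
      · intro hj
        have := h1.1 ⟨hj, by omega⟩
        omega
      · intro hj
        exact (h1.2 (by omega)).1
    rcases h.inter _ _ hI with hM | hM | hM
    · rw [hMi hM]
      refine hstep _ _ (htriv i k le_rfl (by omega) le_rfl fun j hj hjk hjM => ?_) fun _ => hsum y
      exact notMem_empty j (hM ▸ mem_inter.2 ⟨hjM, mem_Icc.2 (by omega)⟩)
    · have hM' := hmem hM
      rw [hsign (i + 1) (by omega) (by omega) hM]
      refine hstep (stepAt (i + 1) 1 (-1 / 2) (P.transfer α β i)) _ ?_ fun hy => ?_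
      · rw [htriv (i + 2) k (by omega) hik2 le_rfl fun j hj hjk hjM => by
            have := (hM' j (by omega) hjk).1 hjM; omega,
          hone (i + 1) (by omega) (by omega) ((hM' _ (by omega) (by omega)).2 (by omega)),
          hone i (by omega) (by omega) ((hM' _ (by omega) (by omega)).2 (by omega)),
          hP.stepAt_stepAt_left hsupp]
      · rw [sum_lt_stepAt]
        exact hP.sum_lt_mul_nonpos hsupp (by omega) (by omega) (ih i him hiV)
    · obtain ⟨c, rfl⟩ : ∃ c, k = c + 2 := ⟨k - 2, by omega⟩
      have hM : M ∩ Icc (i + 1) (c + 2) = Icc (c + 1) (c + 1 + 1) := hM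
      have hM' := hmem hM
      rw [hsign (c + 1) (by omega) (by omega) hM]
      refine hstep (stepAt (c + 2) 1 (-1 / 2) (stepAt (c + 1) 1 (-1 / 2) (P.transfer α β i))) _
        ?_ fun hy => ?_
      · rw [hone (c + 1) (by omega) (by omega) ((hM' _ (by omega) (by omega)).2 (by omega)),
          hone c (by omega) (by omega) ((hM' _ (by omega) (by omega)).2 (by omega)),
          htriv i c (by omega) (by omega) (by omega) fun j hj hjk hjM => by
            have := (hM' j (by omega) (by omega)).1 hjM; omega]
      · rw [hP.sum_lt_stepAt_stepAt_right (j := c + 1) (by omega)]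
        exact hP.sum_lt_mul_nonpos hsupp (by omega) (by omega) (ih i him hiV)

theorem IsEulerian.facetForm_nonneg (hP : P.IsEulerian) {n : ℕ} (hn : P.rank = n + 1)
    {M V : Finset ℕ} (h : IsFacetPair n M V) : 0 ≤ facetForm n M V (flagVector n P) := by
  have hV : n + 1 ∉ V := fun h' => by have := mem_Icc.1 (h.subset h'); omega
  have hM : n + 1 ∉ M := fun h' => hV (h.subset' h')
  have h1 := hP.transfer_sign h (n + 1) hV ⊤
  have h2 : M ∩ Icc 1 (n + 1) = M := inter_eq_left.2 <|
    (h.subset'.trans h.subset).trans (Icc_subset_Icc le_rfl (by omega))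
  rw [h2, transfer_succ_of_eq _ _ n (a := 0) (b := 1 / 2) (by simp [hV]) (by simp [hV, hM]),
    stepAt, if_pos (show P.rk ⊤ = n + 1 from hn)] at h1
  rw [facetForm_apply h.subset' h.subset, weightedSum_flagVector hn]
  linarith

/-! ### The entries of the `L`-vector that vanish -/

/-- The matrix `W = 2 (1 + ζ)⁻¹`. The Eulerian relation says that conjugation by the sign
`(-1) ^ ρ` inverts `ζ`, so it takes `W` to `2 - W`: off the diagonal, `W` vanishes on pairs whose
ranks differ by an even number. -/
theorem IsEulerian.exists_halfInverse (hP : P.IsEulerian) : ∃ W : P → P → ℝ,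
    (∀ x y, 2 * W x y + ∑ z with z < y, W x z = if x = y then 2 else 0) ∧
    ∀ x y, x ≠ y → Even (P.rk x + P.rk y) → W x y = 0 := by
  set Z : Matrix P P ℝ := Matrix.of fun x y => if x ≤ y then 1 else 0 with hZ
  set D : Matrix P P ℝ := Matrix.diagonal fun x => (-1) ^ P.rk x with hD
  have hDD : D * D = 1 := by
    rw [hD, Matrix.diagonal_mul_diagonal, ← Matrix.diagonal_one]
    congr 1
    funext x
    rw [← mul_pow]
    norm_num
  have happ : ∀ Y : Matrix P P ℝ, ∀ x y, (Y * (1 + Z)) x y =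
      2 * Y x y + ∑ z with z < y, Y x z := by
    intro Y x y
    have h1 : ({z | z ≤ y} : Finset P) = insert y ({z | z < y} : Finset P) := by
      ext z
      simp [le_iff_eq_or_lt]
    rw [mul_add, mul_one, Matrix.add_apply, Matrix.mul_apply]
    simp only [hZ, Matrix.of_apply, mul_ite, mul_one, mul_zero]
    rw [← sum_filter, h1, sum_insert (by simp)]
    ring
  have hinj : ∀ Y : Matrix P P ℝ, Y * (1 + Z) = 0 → Y = 0 := by
    intro Y hY
    ext x y
    induction y using WellFoundedLT.induction with
    | ind y ih =>
      have h1 := happ Y x y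
      rw [hY, sum_eq_zero fun z hz => ih z (mem_filter.1 hz).2] at h1
      simpa using h1.symm
  obtain ⟨W, hW⟩ : ∃ W : Matrix P P ℝ, W * (1 + Z) = 2 := by
    have h1 : Function.Injective (LinearMap.mulRight ℝ (1 + Z)) :=
      (injective_iff_map_eq_zero _).2 fun Y hY => hinj Y hY
    exact (LinearMap.injective_iff_surjective.1 h1) 2
  have hE : D * Z * D * Z = 1 := by
    have h1 : ∀ x y, (Z * D * Z) x y = D x y := by
      intro x y
      simp only [hZ, hD, Matrix.mul_apply, Matrix.of_apply, Matrix.diagonal_apply,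
        ite_mul, one_mul, zero_mul, mul_ite, mul_one, mul_zero, sum_ite_eq', mem_univ, if_true]
      have h2 : ∑ z, (if z ≤ y then if x ≤ z then (-1 : ℝ) ^ P.rk z else 0 else 0) =
          ∑ z with x ≤ z ∧ z ≤ y, (-1 : ℝ) ^ P.rk z := by
        rw [sum_filter]
        refine sum_congr rfl fun z _ => ?_
        by_cases h3 : x ≤ z <;> by_cases h4 : z ≤ y <;> simp [h3, h4]
      rw [h2]
      rcases eq_or_ne x y with rfl | hne
      · rw [if_pos rfl, sum_eq_single x]
        · intro z hz hzx
          exact absurd (le_antisymm (mem_filter.1 hz).2.2 (mem_filter.1 hz).2.1) hzx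
        · simp
      · rw [if_neg hne]
        by_cases hxy : x ≤ y
        · have h3 := isEulerian_iff.1 hP x y (lt_of_le_of_ne hxy hne)
          exact_mod_cast congrArg (Int.cast : ℤ → ℝ) h3
        · refine sum_eq_zero fun z hz => absurd ?_ hxy
          exact (mem_filter.1 hz).2.1.trans (mem_filter.1 hz).2.2
    have h2 : Z * D * Z = D := by
      ext x y
      exact h1 x y
    calc D * Z * D * Z = D * (Z * D * Z) := by noncomm_ring
      _ = 1 := by rw [h2, hDD]
  have hWZ : W * Z = 2 - W := by
    rw [mul_add, mul_one] at hW
    exact eq_sub_of_add_eq' hW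
  have hX : D * W * D * Z = 2 * Z - D * W * D := by
    have h1 : D * W * D * (D * Z * D) = 2 - D * W * D := by
      calc D * W * D * (D * Z * D) = D * W * (D * D) * Z * D := by noncomm_ring
        _ = D * (W * Z) * D := by rw [hDD]; noncomm_ring
        _ = 2 * (D * D) - D * W * D := by rw [hWZ]; noncomm_ring
        _ = 2 - D * W * D := by rw [hDD, mul_one]
    calc D * W * D * Z = 2 * Z - (2 - D * W * D) * Z := by noncomm_ring
      _ = 2 * Z - D * W * D * (D * Z * D * Z) := by rw [← h1]; noncomm_ring
      _ = 2 * Z - D * W * D := by rw [hE, mul_one]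
  have hfin : W = 2 - D * W * D := by
    refine sub_eq_zero.1 (hinj _ ?_)
    calc (W - (2 - D * W * D)) * (1 + Z)
        = W * (1 + Z) - 2 - 2 * Z + D * W * D + D * W * D * Z := by noncomm_ring
      _ = 0 := by rw [hW, hX]; noncomm_ring
  refine ⟨W, fun x y => ?_, fun x y hxy hev => ?_⟩
  · rw [← happ W x y, hW, ← Nat.cast_two, Matrix.natCast_apply]
    split_ifs <;> simp
  · have h1 := congrFun (congrFun hfin x) y
    have h2 : (2 : Matrix P P ℝ) x y = 0 := by
      rw [← Nat.cast_two, Matrix.natCast_apply, if_neg hxy, Nat.cast_zero]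
    have h3 : (-1 : ℝ) ^ P.rk x * (-1) ^ P.rk y = 1 := by rw [← pow_add, hev.neg_one_pow]
    rw [Matrix.sub_apply, h2, hD, Matrix.mul_diagonal, Matrix.diagonal_mul] at h1
    linear_combination h1 / 2 - W x y * h3 / 2

/-- Using every rank of a gap with the weights `1, -1 / 2` gives zero if the gap has odd length. -/
theorem IsEulerian.sum_lt_transfer_eq_zero (hP : P.IsEulerian) {α β : ℕ → ℝ} {i k : ℕ}
    (hik : i ≤ k) (hodd : Even (i + (k + 1))) (hi : SupportedOn i (P.transfer α β i))
    (hα : ∀ j, i < j → j ≤ k → α j = 1 ∧ β j = -1 / 2) {y : P} (hy : P.rk y = k + 1) :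
    ∑ z with z < y, P.transfer α β k z = 0 := by
  obtain ⟨W, hW, hW0⟩ := hP.exists_halfInverse
  set u := P.transfer α β i with hu
  have hle : ∀ x y, ¬ x ≤ y → W x y = 0 := by
    intro x y
    induction y using WellFoundedLT.induction with
    | ind y ih =>
      intro hxy
      have h1 := hW x y
      rw [if_neg fun h => hxy h.le, sum_eq_zero fun z hz => ih z (mem_filter.1 hz).2
        fun h => hxy (h.trans (mem_filter.1 hz).2.le)] at h1
      linarith
  have hself : ∀ x, W x x = 1 := by
    intro x
    have h1 := hW x x
    rw [if_pos rfl, sum_eq_zero fun z hz => hle x z (not_le_of_gt (mem_filter.1 hz).2)] at h1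
    linarith
  -- summing the columns of `W` below `y`, by the equation that defines `W`
  have hsum : ∀ y : P, i < P.rk y → ∑ z with z < y, ∑ x, u x * W x z = -2 * ∑ x, u x * W x y := by
    intro y hy
    rw [sum_comm, mul_sum]
    refine sum_congr rfl fun x _ => ?_
    rw [← mul_sum]
    by_cases hx : P.rk x = i
    · have h1 := hW x y
      rw [if_neg fun h => by subst h; omega] at h1
      linear_combination u x * h1
    · simp [hi x hx]
  have key : ∀ m, i ≤ m → m ≤ k → ∀ y : P,
      P.transfer α β m y = if P.rk y ≤ m then ∑ x, u x * W x y else 0 := by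
    intro m him
    induction m, him using Nat.le_induction with
    | base =>
      intro _ y
      split_ifs with hy
      · rw [sum_eq_single y, hself, mul_one]
        · intro x _ hxy
          by_cases hx : P.rk x = i
          · rw [hle x y fun h => ?_, mul_zero]
            have := rk_lt_rk (lt_of_le_of_ne h hxy)
            omega
          · rw [hi x hx, zero_mul]
        · simp
      · exact hi y (by omega)
    | succ m him ih =>
      intro hmk y
      have ih := ih (by omega)
      obtain ⟨h1, h2⟩ := hα (m + 1) (by omega) hmk
      rw [transfer_succ_of_eq α β m h1 h2, stepAt, ih y]
      by_cases hy : P.rk y = m + 1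
      · have h3 : ∑ z with z < y, P.transfer α β m z = ∑ z with z < y, ∑ x, u x * W x z := by
          refine sum_congr rfl fun z hz => ?_
          have := rk_lt_rk (mem_filter.1 hz).2
          rw [ih z, if_pos (by omega)]
        rw [if_neg (by omega), if_pos hy, if_pos hy.le, h3, hsum y (by omega)]
        ring
      · by_cases hy' : P.rk y ≤ m
        · rw [if_pos hy', if_neg hy, if_pos (by omega)]
          ring
        · rw [if_neg hy', if_neg hy, if_neg (by omega)]
          ring
  have h3 : ∑ z with z < y, P.transfer α β k z = ∑ z with z < y, ∑ x, u x * W x z := by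
    refine sum_congr rfl fun z hz => ?_
    have := rk_lt_rk (mem_filter.1 hz).2
    rw [key k hik le_rfl z, if_pos (by omega)]
  rw [h3, hsum y (by omega), sum_eq_zero, mul_zero]
  intro x _
  by_cases hx : P.rk x = i
  · rw [hW0 x y (fun h => by subst h; omega) (by rwa [hx, hy]), mul_zero]
  · rw [hi x hx, zero_mul]

end GradedPoset

/-- All maximal intervals of `S` have an even number of elements. -/
def IsEvenSet (S : Finset ℕ) : Prop := ∀ a b, IsMaximalInterval S a b → Even (Icc a b).card

namespace GradedPoset

open scoped Classical

variable {P : GradedPoset}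

theorem IsEulerian.LForm_eq_zero (hP : P.IsEulerian) {n : ℕ} (hn : P.rank = n + 1)
    {Q : Finset ℕ} (hQ : Q ⊆ Icc 1 n) (hodd : ¬ IsEvenSet Q) :
    LForm n Q (flagVector n P) = 0 := by
  simp only [IsEvenSet, not_forall] at hodd
  obtain ⟨a, b, hab, hodd⟩ := hodd
  obtain ⟨hab, hsub, ha, hb⟩ := isMaximalInterval_iff.1 hab
  have ha1 := (mem_Icc.1 (hQ (hsub (mem_Icc.2 ⟨le_rfl, hab⟩)))).1
  have hbn := (mem_Icc.1 (hQ (hsub (mem_Icc.2 ⟨hab, le_rfl⟩)))).2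
  have hnQ : n + 1 ∉ Q := fun h => by have := mem_Icc.1 (hQ h); omega
  rw [LForm_eq_weightedSum hQ, weightedSum_flagVector hn]
  set α : ℕ → ℝ := fun j => if j ∈ Q then 1 else 0 with hα
  set β : ℕ → ℝ := fun j => if j ∈ Q then -1 / 2 else if j ∈ Q then 0 else 1 / 2 with hβ
  obtain ⟨i, rfl⟩ : ∃ i, a = i + 1 := ⟨a - 1, by omega⟩
  have hi : SupportedOn i (P.transfer α β i) :=
    supportedOn_transfer α β i (Or.inl (by simpa [hα] using ha))
  have hzero : ∀ y : P, P.rk y = b + 1 → ∑ z with z < y, P.transfer α β b z = 0 := fun y hy =>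
    hP.sum_lt_transfer_eq_zero (by omega) (by
      rw [Nat.card_Icc] at hodd
      have h : i + (b + 1) = b + 1 - (i + 1) + (2 * i + 1) := by omega
      rw [h]
      exact (Nat.not_even_iff_odd.1 hodd).add_odd ⟨i, rfl⟩) hi
      (fun j hj hjb => by
        have : j ∈ Q := hsub (mem_Icc.2 (by omega))
        simp [hα, hβ, this]) hy
  rcases hbn.eq_or_lt with rfl | hbn
  · exact hzero ⊤ hn
  · have h1 : ∀ m, b + 1 ≤ m → P.transfer α β m = 0 := by
      intro m hm
      induction m, hm using Nat.le_induction with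
      | base =>
        rw [transfer_succ_of_eq α β b (a := 0) (b := 1 / 2) (by simp [hα, hb]) (by simp [hβ, hb])]
        funext y
        rw [stepAt]
        split_ifs with hy
        · rw [hzero y hy]
          simp
        · simp
      | succ m _ ih =>
        rw [transfer, ih]
        funext y
        simp [stepAt]
    rw [h1 n hbn]
    simp

end GradedPoset

/-! ### Interval posets and their doubles -/

namespace GradedPoset

open scoped Classical

variable {P : GradedPoset}

/-- `P` has rank `n + 1` and, for `x < y`, the number of elements of rank `t` between `x` and `y`
is `g (ρ x) (ρ y) t`. -/
structure HasCounts (P : GradedPoset) (n : ℕ) (g : ℕ → ℕ → ℕ → ℕ) : Prop where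
  rank_eq : P.rank = n + 1
  between_eq : ∀ ⦃x y : P⦄ ⦃t : ℕ⦄, x < y → P.rk x < t → t < P.rk y →
    between x y t = g (P.rk x) (P.rk y) t

/-- The factor by which replacing the ranks in the interval `I` by `k` copies multiplies the number
of elements of rank `t` between two elements of ranks `r` and `s`. -/
def copyFactor (k : ℕ) (I : ℕ × ℕ) (r s t : ℕ) : ℕ :=
  if (I.1 ≤ t ∧ t ≤ I.2) ∧ ¬ (I.1 ≤ r ∧ r ≤ I.2) ∧ ¬ (I.1 ≤ s ∧ s ≤ I.2) then k else 1

theorem inInterval_iff {n a b : ℕ} (hP : P.rank = n + 1) (ha : 1 ≤ a) (hb : b ≤ n) {x : P} :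
    P.InInterval a b x ↔ a ≤ P.rk x ∧ P.rk x ≤ b := by
  refine ⟨fun h => h.2.2, fun h => ⟨?_, ?_, h⟩⟩
  · rintro rfl
    rw [rk_bot] at h
    omega
  · rintro rfl
    have : P.rk ⊤ = n + 1 := hP
    omega

theorem ReplicateCarrier.lt_iff {a b : ℕ} {k : ℕ+} {p q : ReplicateCarrier P a b k} :
    p < q ↔ p.1.1 < q.1.1 ∧
      (P.InInterval a b p.1.1 → P.InInterval a b q.1.1 → p.1.2 = q.1.2) := by
  constructor
  · exact fun h => ⟨fst_lt_of_lt h, h.le.2⟩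
  · exact fun h => lt_of_le_of_ne ⟨h.1.le, h.2⟩ fun hpq => h.1.ne (by rw [hpq])

theorem HasCounts.replicate {n : ℕ} {g : ℕ → ℕ → ℕ → ℕ} (hP : P.HasCounts n g) {a b : ℕ}
    (ha : 1 ≤ a) (hb : b ≤ n) (k : ℕ+) :
    (P.replicate a b k).HasCounts n fun r s t => g r s t * copyFactor k (a, b) r s t := by
  refine ⟨hP.rank_eq, fun p q t hpq hpt htq => ?_⟩
  have hI : ∀ x : P, P.InInterval a b x ↔ a ≤ P.rk x ∧ P.rk x ≤ b :=
    fun x => inInterval_iff hP.rank_eq ha hb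
  have hpq1 := ReplicateCarrier.fst_lt_of_lt hpq
  change between p q t = g (P.rk p.1.1) (P.rk q.1.1) t * _
  rw [← hP.between_eq hpq1 hpt htq]
  have hmem : ∀ r : P.replicate a b k, (p < r ∧ r < q ∧ (P.replicate a b k).rk r = t) ↔
      (p.1.1 < r.1.1 ∧ r.1.1 < q.1.1 ∧ P.rk r.1.1 = t) ∧
      ((a ≤ P.rk p.1.1 ∧ P.rk p.1.1 ≤ b) → (a ≤ t ∧ t ≤ b) → p.1.2 = r.1.2) ∧
      ((a ≤ t ∧ t ≤ b) → (a ≤ P.rk q.1.1 ∧ P.rk q.1.1 ≤ b) → r.1.2 = q.1.2) := by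
    intro r
    have h1 : p < r ↔ _ := ReplicateCarrier.lt_iff
    have h2 : r < q ↔ _ := ReplicateCarrier.lt_iff
    rw [h1, h2, hI, hI, hI]
    change _ ∧ _ ∧ P.rk r.1.1 = t ↔ _
    constructor
    · rintro ⟨⟨h1, h2⟩, ⟨h3, h4⟩, rfl⟩
      exact ⟨⟨h1, h3, rfl⟩, h2, h4⟩
    · rintro ⟨⟨h1, h3, rfl⟩, h2, h4⟩
      exact ⟨⟨h1, h2⟩, ⟨h3, h4⟩, rfl⟩
  unfold copyFactor
  split_ifs with hfree
  · obtain ⟨ht, hp, hq⟩ := hfree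
    -- the copies of an element between `p` and `q` are all between `p` and `q`
    have h1 : between p q t = #(({z | p.1.1 < z ∧ z < q.1.1 ∧ P.rk z = t} : Finset P) ×ˢ
        (univ : Finset (Fin k))) := by
      refine card_nbij (fun r => (r.1.1, r.1.2)) ?_ ?_ ?_
      · intro r hr
        have := (hmem r).1 (mem_filter.1 hr).2
        simpa using this.1
      · intro r _ r' _ h
        exact Subtype.ext h
      · rintro ⟨z, i⟩ hz
        have hz := (mem_filter.1 (mem_product.1 hz).1).2
        have hz' : P.InInterval a b z := (hI z).2 (hz.2.2 ▸ ht)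
        refine ⟨(⟨(z, i), fun h => absurd hz' h⟩ : ReplicateCarrier P a b k), ?_, rfl⟩
        exact mem_filter.2 ⟨mem_univ _,
          (hmem _).2 ⟨hz, fun h => absurd h hp, fun _ h => absurd h hq⟩⟩
    rw [h1, card_product, card_univ, Fintype.card_fin]
    rfl
  · rw [mul_one]
    -- the index of a copy between `p` and `q` is determined
    obtain ⟨i, hi0, hi⟩ : ∃ i : Fin k, (¬ (a ≤ t ∧ t ≤ b) → (i : ℕ) = 0) ∧
        ∀ r : P.replicate a b k, P.rk r.1.1 = t →
        ((((a ≤ P.rk p.1.1 ∧ P.rk p.1.1 ≤ b) → (a ≤ t ∧ t ≤ b) → p.1.2 = r.1.2) ∧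
          ((a ≤ t ∧ t ≤ b) → (a ≤ P.rk q.1.1 ∧ P.rk q.1.1 ≤ b) → r.1.2 = q.1.2)) ↔
          r.1.2 = i) := by
      by_cases ht : a ≤ t ∧ t ≤ b
      · have hpq2 := hpq.le.2
        rw [hI, hI] at hpq2
        by_cases hp : a ≤ P.rk p.1.1 ∧ P.rk p.1.1 ≤ b
        · refine ⟨p.1.2, fun h => absurd ht h, fun r _ => ⟨fun h => (h.1 hp ht).symm, fun h =>
            ⟨fun _ _ => h.symm, fun _ hq => h.trans (hpq2 hp hq)⟩⟩⟩
        · have hq : a ≤ P.rk q.1.1 ∧ P.rk q.1.1 ≤ b := by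
            by_contra hq
            exact hfree ⟨ht, hp, hq⟩
          exact ⟨q.1.2, fun h => absurd ht h, fun r _ => ⟨fun h => h.2 ht hq, fun h =>
            ⟨fun hp' => absurd hp' hp, fun _ _ => h⟩⟩⟩
      · refine ⟨⟨0, k.pos⟩, fun _ => rfl, fun r hr => ⟨fun _ => Fin.ext (r.2 fun h => ?_), fun _ =>
          ⟨fun _ h => absurd h ht, fun h => absurd h ht⟩⟩⟩
        exact ht (hr ▸ (hI _).1 h)
    have hval : ∀ z : P, P.rk z = t → ¬ P.InInterval a b z → (i : ℕ) = 0 := fun z hz h =>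
      hi0 fun h' => h ((hI z).2 (hz ▸ h'))
    refine card_nbij (fun r => r.1.1) ?_ ?_ ?_
    · intro r hr
      exact mem_filter.2 ⟨mem_univ _, ((hmem r).1 (mem_filter.1 hr).2).1⟩
    · intro r hr r' hr' h
      have h1 := (hmem r).1 (mem_filter.1 hr).2
      have h2 := (hmem r').1 (mem_filter.1 hr').2
      exact Subtype.ext (Prod.ext h (((hi r h1.1.2.2).1 h1.2).trans
        ((hi r' h2.1.2.2).1 h2.2).symm))
    · intro z hz
      have hz := (mem_filter.1 hz).2
      refine ⟨(⟨(z, i), hval z hz.2.2⟩ : ReplicateCarrier P a b k), ?_, rfl⟩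
      exact mem_filter.2 ⟨mem_univ _, (hmem _).2 ⟨hz, (hi _ hz.2.2).2 rfl⟩⟩

theorem HasCounts.replicateSystem {n : ℕ} {g : ℕ → ℕ → ℕ → ℕ} (hP : P.HasCounts n g)
    {𝓘 : Finset (ℕ × ℕ)} (h𝓘 : ∀ I ∈ 𝓘, 1 ≤ I.1 ∧ I.2 ≤ n) (k : ℕ+) :
    (P.replicateSystem 𝓘 k).HasCounts n
      fun r s t => g r s t * ∏ I ∈ 𝓘, copyFactor k I r s t := by
  have key : ∀ (l : List (ℕ × ℕ)) (Q : GradedPoset) (g : ℕ → ℕ → ℕ → ℕ), Q.HasCounts n g →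
      (∀ I ∈ l, 1 ≤ I.1 ∧ I.2 ≤ n) →
      (l.foldl (fun Q I => Q.replicate I.1 I.2 k) Q).HasCounts n
        fun r s t => g r s t * (l.map fun I => copyFactor k I r s t).prod := by
    intro l
    induction l with
    | nil =>
      intro Q g hQ _
      simpa using hQ
    | cons I l ih =>
      intro Q g hQ hl
      have hI := hl I (by simp)
      have h := ih _ _ (hQ.replicate hI.1 hI.2 k) fun J hJ => hl J (by simp [hJ])
      simpa only [List.foldl_cons, List.map_cons, List.prod_cons, mul_assoc] using h
  have h := key 𝓘.toList P g hP fun I hI => h𝓘 I (by simpa using hI)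
  simp only [prod_map_toList] at h
  exact h

theorem hasCounts_chain (n : ℕ) : (chain n).HasCounts n fun _ _ _ => 1 := by
  refine ⟨rfl, fun x y t _ hxt hty => ?_⟩
  have hx : x.1 < t := hxt
  have hy : t < y.1 := hty
  have hyn : y.1 < n + 2 := y.2
  rw [between, card_eq_one]
  let w : chain n := (⟨t, by omega⟩ : Fin (n + 2))
  refine ⟨w, ?_⟩
  ext z
  simp only [mem_filter, mem_univ, true_and, mem_singleton]
  constructor
  · rintro ⟨-, -, hz⟩
    exact Fin.ext (show z.1 = t from hz)
  · rintro rfl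
    exact ⟨Fin.lt_def.2 hx, Fin.lt_def.2 hy, rfl⟩

/-- Between two elements of ranks `r < t < s`, the poset `D P(n, 𝓘, N)` has twice as many elements
of rank `t` as there are choices of a copy for every interval that contains `t` but neither `r`
nor `s`. -/
theorem hasCounts_double {n : ℕ} {𝓘 : Finset (ℕ × ℕ)} (h𝓘 : ∀ I ∈ 𝓘, 1 ≤ I.1 ∧ I.2 ≤ n)
    (N : ℕ+) : ((intervalPoset n 𝓘 N).horizontalDouble n).HasCounts n fun r s t =>
      2 * (N : ℕ) ^ #{I ∈ 𝓘 | (I.1 ≤ t ∧ t ≤ I.2) ∧ ¬ (I.1 ≤ r ∧ r ≤ I.2) ∧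
        ¬ (I.1 ≤ s ∧ s ≤ I.2)} := by
  have h1 := ((hasCounts_chain n).replicateSystem h𝓘 N).replicateSystem
    (𝓘 := (Icc 1 n).image fun i => (i, i)) (by
      intro I hI
      obtain ⟨i, hi, rfl⟩ := mem_image.1 hI
      exact mem_Icc.1 hi) 2
  refine ⟨h1.rank_eq, fun x y t hxy hxt hty => ?_⟩
  rw [show between x y t = _ from h1.between_eq hxy hxt hty]
  have hyn : ((intervalPoset n 𝓘 N).horizontalDouble n).rk y ≤ n + 1 :=
    (rk_le_rk le_top).trans_eq h1.rank_eq
  have h2 : ∀ r s : ℕ, r < t → t < s → s ≤ n + 1 →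
      ∏ I ∈ (Icc 1 n).image (fun i => (i, i)), copyFactor 2 I r s t = 2 := by
    intro r s hr hs hsn
    rw [prod_image fun i _ j _ h => congrArg Prod.fst h, prod_eq_single t]
    · rw [copyFactor, if_pos (by dsimp only; omega)]
    · intro i _ hi
      rw [copyFactor, if_neg (by dsimp only; omega)]
    · intro h
      exact absurd (mem_Icc.2 (by omega)) h
  rw [one_mul, mul_comm, show ((2 : ℕ+) : ℕ) = 2 from rfl]
  refine congrArg₂ (· * ·) (h2 _ _ hxt hty hyn) ?_
  simp only [copyFactor]
  rw [← prod_filter, prod_const]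
  rfl

/-! ### Flag numbers and the Eulerian relation for the doubles -/

theorem card_chainsBelow_of_hasCounts {n N : ℕ} {𝓘 : Finset (ℕ × ℕ)} (h𝓘 : ∀ I ∈ 𝓘, 1 ≤ I.1)
    (hP : P.HasCounts n fun r s t => 2 * N ^ #{I ∈ 𝓘 | (I.1 ≤ t ∧ t ≤ I.2) ∧
      ¬ (I.1 ≤ r ∧ r ≤ I.2) ∧ ¬ (I.1 ≤ s ∧ s ≤ I.2)}) (T : Finset ℕ) (y : P)
    (hT : ∀ t ∈ T, 1 ≤ t ∧ t < P.rk y) : (chainsBelow T y).card =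
      2 ^ T.card * N ^ #{I ∈ 𝓘 | (∃ t ∈ T, I.1 ≤ t ∧ t ≤ I.2) ∧
        ¬ (I.1 ≤ P.rk y ∧ P.rk y ≤ I.2)} := by
  induction T using Finset.induction_on_max generalizing y with
  | empty => simp [card_chainsBelow_empty]
  | insert s T hs ih =>
    have hs1 := hT s (mem_insert_self s T)
    have hsT : s ∉ T := fun h => lt_irrefl _ (hs s h)
    rw [card_chainsBelow_insert hs]
    have h1 : ∀ z ∈ ({z | z < y ∧ P.rk z = s} : Finset P), (chainsBelow T z).card =
        2 ^ T.card * N ^ #{I ∈ 𝓘 | (∃ t ∈ T, I.1 ≤ t ∧ t ≤ I.2) ∧ ¬ (I.1 ≤ s ∧ s ≤ I.2)} := by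
      intro z hz
      have hz := (mem_filter.1 hz).2.2
      rw [ih z fun t ht => ⟨(hT t (mem_insert_of_mem ht)).1, hz ▸ hs t ht⟩, hz]
    rw [sum_congr rfl h1, sum_const, smul_eq_mul]
    have h2 : #({z | z < y ∧ P.rk z = s} : Finset P) = between ⊥ y s := by
      rw [between]
      congr 1
      ext z
      simp only [mem_filter, mem_univ, true_and]
      refine ⟨fun h => ⟨bot_lt_iff_ne_bot.2 fun hz => ?_, h⟩, fun h => h.2⟩
      rw [hz, rk_bot] at h
      omega
    have hby : ⊥ < y := bot_lt_iff_ne_bot.2 fun h => by rw [h, rk_bot] at hs1; omega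
    rw [h2, hP.between_eq hby (by rw [rk_bot]; omega) hs1.2, rk_bot, card_insert_of_notMem hsT]
    -- an interval that meets `T` and contains `s`, or a later rank, is counted once
    have h3 : #{I ∈ 𝓘 | (∃ t ∈ insert s T, I.1 ≤ t ∧ t ≤ I.2) ∧
        ¬ (I.1 ≤ P.rk y ∧ P.rk y ≤ I.2)} =
        #{I ∈ 𝓘 | (I.1 ≤ s ∧ s ≤ I.2) ∧ ¬ (I.1 ≤ 0 ∧ 0 ≤ I.2) ∧
          ¬ (I.1 ≤ P.rk y ∧ P.rk y ≤ I.2)} +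
        #{I ∈ 𝓘 | (∃ t ∈ T, I.1 ≤ t ∧ t ≤ I.2) ∧ ¬ (I.1 ≤ s ∧ s ≤ I.2)} := by
      rw [← card_union_of_disjoint]
      · congr 1
        ext I
        simp only [mem_filter, mem_union, exists_mem_insert]
        constructor
        · rintro ⟨hI, h4 | ⟨t, ht, h4⟩, h5⟩
          · exact Or.inl ⟨hI, h4, by have := h𝓘 I hI; omega, h5⟩
          · by_cases h6 : I.1 ≤ s ∧ s ≤ I.2
            · exact Or.inl ⟨hI, h6, by have := h𝓘 I hI; omega, h5⟩
            · exact Or.inr ⟨hI, ⟨t, ht, h4⟩, h6⟩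
        · rintro (⟨hI, h4, -, h5⟩ | ⟨hI, ⟨t, ht, h4⟩, h6⟩)
          · exact ⟨hI, Or.inl h4, h5⟩
          · refine ⟨hI, Or.inr ⟨t, ht, h4⟩, ?_⟩
            have := hs t ht
            omega
      · refine disjoint_left.2 fun I h4 h5 => ?_
        exact (mem_filter.1 h5).2.2 (mem_filter.1 h4).2.1
    rw [h3, pow_add, pow_succ]
    ring

theorem sum_neg_one_pow_Ioo {r s : ℕ} (h : r < s) :
    (-1 : ℤ) ^ r + (-1) ^ s + 2 * ∑ t ∈ Ioo r s, (-1 : ℤ) ^ t = 0 := by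
  induction s, h using Nat.le_induction with
  | base =>
    have h0 : Ioo r (r + 1) = ∅ :=
      eq_empty_of_forall_notMem fun t ht => by have := mem_Ioo.1 ht; omega
    rw [h0, sum_empty, pow_succ]
    ring
  | succ s hs ih =>
    have h1 : Ioo r (s + 1) = insert s (Ioo r s) := by
      ext t
      simp only [mem_Ioo, mem_insert]
      omega
    rw [h1, sum_insert (by simp), pow_succ]
    linear_combination ih

theorem sum_neg_one_pow_Icc {a b : ℕ} (ha : 1 ≤ a) (h : Even (Icc a b).card) :
    ∑ t ∈ Icc a b, (-1 : ℤ) ^ t = 0 := by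
  rcases Nat.lt_or_ge b a with hab | hab
  · simp [Icc_eq_empty_of_lt hab]
  · have h1 := sum_neg_one_pow_Ioo (show a - 1 < b + 1 by omega)
    rw [Nat.card_Icc] at h
    have h2 : (-1 : ℤ) ^ (b + 1) = -(-1) ^ (a - 1) := by
      rw [show b + 1 = (a - 1) + (b + 1 - a) + 1 by omega, pow_succ, pow_add, h.neg_one_pow]
      ring
    rw [show Ioo (a - 1) (b + 1) = Icc a b by ext t; simp only [mem_Ioo, mem_Icc]; omega, h2] at h1
    linarith

/-- The alternating sum behind the Eulerian relation. Writing `N ^ c` as the sum of the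
`(N - 1) ^ |A|` over the subsets `A` of a set of `c` intervals, the ranks that belong to all the
intervals of a nonempty `A` form the intersection of two members of `A`, which is even. -/
theorem sum_neg_one_pow_mul_pow {n : ℕ} {𝓘 : Finset (ℕ × ℕ)} (h𝓘 : IsEvenIntervalSystem n 𝓘)
    (N : ℕ) {r s : ℕ} (h : r < s) : (-1 : ℤ) ^ r + (-1) ^ s + ∑ t ∈ Ioo r s, (-1 : ℤ) ^ t *
      (2 * (N : ℤ) ^ #{I ∈ 𝓘 | (I.1 ≤ t ∧ t ≤ I.2) ∧ ¬ (I.1 ≤ r ∧ r ≤ I.2) ∧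
        ¬ (I.1 ≤ s ∧ s ≤ I.2)}) = 0 := by
  set J : Finset (ℕ × ℕ) := {I ∈ 𝓘 | ¬ (I.1 ≤ r ∧ r ≤ I.2) ∧ ¬ (I.1 ≤ s ∧ s ≤ I.2)} with hJ
  have hpow : ∀ t, (N : ℤ) ^ #{I ∈ 𝓘 | (I.1 ≤ t ∧ t ≤ I.2) ∧ ¬ (I.1 ≤ r ∧ r ≤ I.2) ∧
      ¬ (I.1 ≤ s ∧ s ≤ I.2)} = ∑ A ∈ J.powerset,
        if ∀ I ∈ A, I.1 ≤ t ∧ t ≤ I.2 then ((N : ℤ) - 1) ^ A.card else 0 := by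
    intro t
    set F : Finset (ℕ × ℕ) := {I ∈ 𝓘 | (I.1 ≤ t ∧ t ≤ I.2) ∧ ¬ (I.1 ≤ r ∧ r ≤ I.2) ∧
      ¬ (I.1 ≤ s ∧ s ≤ I.2)} with hF
    have h1 := sum_pow_mul_eq_add_pow ((N : ℤ) - 1) 1 F
    simp only [one_pow, mul_one, sub_add_cancel] at h1
    rw [← h1, ← sum_filter]
    refine sum_congr ?_ fun _ _ => rfl
    ext A
    simp only [mem_powerset, mem_filter, subset_iff, hF, hJ]
    exact ⟨fun h => ⟨fun I hI => ⟨(h hI).1, (h hI).2.2⟩, fun I hI => (h hI).2.1⟩,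
      fun h I hI => ⟨(h.1 hI).1, h.2 I hI, (h.1 hI).2⟩⟩
  have hA : ∀ A ∈ J.powerset, A ≠ ∅ →
      ∑ t ∈ Ioo r s with ∀ I ∈ A, I.1 ≤ t ∧ t ≤ I.2, (-1 : ℤ) ^ t = 0 := by
    intro A hA hne
    have hne := nonempty_iff_ne_empty.2 hne
    obtain ⟨I, hI, hImax⟩ := exists_max_image A Prod.fst hne
    obtain ⟨K, hK, hKmin⟩ := exists_min_image A Prod.snd hne
    have hIJ := (mem_filter.1 (mem_powerset.1 hA hI))
    have hKJ := (mem_filter.1 (mem_powerset.1 hA hK))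
    rcases ({t ∈ Ioo r s | ∀ I ∈ A, I.1 ≤ t ∧ t ≤ I.2} : Finset ℕ).eq_empty_or_nonempty with
      h1 | ⟨u, hu⟩
    · rw [h1, sum_empty]
    · have hu' := mem_filter.1 hu
      have hus := mem_Ioo.1 hu'.1
      have huI := hu'.2 I hI
      have huK := hu'.2 K hK
      have h2 : ({t ∈ Ioo r s | ∀ I ∈ A, I.1 ≤ t ∧ t ≤ I.2} : Finset ℕ) = Icc I.1 K.2 := by
        ext t
        simp only [mem_filter, mem_Ioo, mem_Icc]
        constructor
        · exact fun h => ⟨(h.2 I hI).1, (h.2 K hK).2⟩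
        · refine fun h => ⟨by omega, fun L hL => ⟨?_, ?_⟩⟩
          · exact (hImax L hL).trans h.1
          · exact h.2.trans (hKmin L hL)
      have h3 : Icc I.1 I.2 ∩ Icc K.1 K.2 = Icc I.1 K.2 := by
        have := hImax K hK
        have := hKmin I hI
        ext t
        simp only [mem_inter, mem_Icc]
        omega
      rw [h2]
      exact sum_neg_one_pow_Icc (h𝓘.1.1 I hIJ.1).1 (h3 ▸ h𝓘.2 I hIJ.1 K hKJ.1)
  have h1 : ∑ t ∈ Ioo r s, (-1 : ℤ) ^ t * (2 * (N : ℤ) ^ #{I ∈ 𝓘 | (I.1 ≤ t ∧ t ≤ I.2) ∧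
      ¬ (I.1 ≤ r ∧ r ≤ I.2) ∧ ¬ (I.1 ≤ s ∧ s ≤ I.2)}) = ∑ A ∈ J.powerset,
      2 * ((N : ℤ) - 1) ^ A.card *
        ∑ t ∈ Ioo r s with ∀ I ∈ A, I.1 ≤ t ∧ t ≤ I.2, (-1 : ℤ) ^ t := by
    simp only [hpow, mul_sum, sum_filter]
    rw [sum_comm]
    refine sum_congr rfl fun A _ => sum_congr rfl fun t _ => ?_
    split_ifs <;> ring
  rw [h1, sum_eq_single ∅ (fun A hA' hne => by rw [hA A hA' hne, mul_zero]) (by simp)]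
  simpa using sum_neg_one_pow_Ioo h

theorem isEulerian_double {n : ℕ} {𝓘 : Finset (ℕ × ℕ)} (h𝓘 : IsEvenIntervalSystem n 𝓘) (N : ℕ+) :
    ((intervalPoset n 𝓘 N).horizontalDouble n).IsEulerian := by
  have hc := hasCounts_double (n := n) (𝓘 := 𝓘) (fun I hI => ⟨(h𝓘.1.1 I hI).1, (h𝓘.1.1 I hI).2.2⟩) N
  set P := (intervalPoset n 𝓘 N).horizontalDouble n
  refine isEulerian_iff.2 fun x y hxy => ?_
  have hset : ({z | x ≤ z ∧ z ≤ y} : Finset P) =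
      insert x (insert y ({z | x < z ∧ z < y} : Finset P)) := by
    ext z
    simp only [mem_filter, mem_univ, true_and, mem_insert]
    constructor
    · rintro ⟨hxz, hzy⟩
      rcases hxz.eq_or_lt with rfl | hxz
      · simp
      rcases hzy.eq_or_lt with rfl | hzy
      · simp
      exact Or.inr (Or.inr ⟨hxz, hzy⟩)
    · rintro (rfl | rfl | hz)
      · exact ⟨le_rfl, hxy.le⟩
      · exact ⟨hxy.le, le_rfl⟩
      · exact ⟨hz.1.le, hz.2.le⟩
  rw [hset, sum_insert (by simp [hxy.ne]), sum_insert (by simp), ← add_assoc,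
    ← sum_neg_one_pow_mul_pow h𝓘 N (rk_lt_rk hxy)]
  congr 1
  rw [← sum_fiberwise_of_maps_to (t := Ioo (P.rk x) (P.rk y)) (g := P.rk) fun z hz =>
    mem_Ioo.2 ⟨rk_lt_rk (mem_filter.1 hz).2.1, rk_lt_rk (mem_filter.1 hz).2.2⟩]
  refine sum_congr rfl fun t ht => ?_
  have ht := mem_Ioo.1 ht
  have h1 := hc.between_eq hxy ht.1 ht.2
  rw [sum_congr rfl (g := fun _ => (-1 : ℤ) ^ t) fun z hz => by rw [(mem_filter.1 hz).2],
    sum_const, nsmul_eq_mul, mul_comm]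
  congr 1
  rw [filter_filter]
  simp only [and_assoc] at h1 ⊢
  exact_mod_cast h1

end GradedPoset

/-! ### The flag vectors of the doubled limit posets -/

/-- `T` meets every interval of the system `𝓘`. -/
def Meets (T : Finset ℕ) (𝓘 : Finset (ℕ × ℕ)) : Prop :=
  ∀ I ∈ 𝓘, ∃ t ∈ T, I.1 ≤ t ∧ t ≤ I.2

instance (T : Finset ℕ) (𝓘 : Finset (ℕ × ℕ)) : Decidable (Meets T 𝓘) := by
  unfold Meets; infer_instance

/-- The closed form of the flag vector of `D P(n, 𝓘)`. -/
noncomputable def rayVector (n : ℕ) (𝓘 : Finset (ℕ × ℕ)) : FlagSpace n :=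
  fun T => 2 ^ T.1.card * if Meets T.1 𝓘 then 1 else 0

theorem flagVector_double {n : ℕ} {𝓘 : Finset (ℕ × ℕ)} (h𝓘 : ∀ I ∈ 𝓘, 1 ≤ I.1 ∧ I.2 ≤ n) (N : ℕ+)
    (S : (Icc 1 n).powerset) :
    flagVector n ((intervalPoset n 𝓘 N).horizontalDouble n) S =
      2 ^ S.1.card * ((N : ℕ) : ℝ) ^ #{I ∈ 𝓘 | ∃ t ∈ S.1, I.1 ≤ t ∧ t ≤ I.2} := by
  have hc := GradedPoset.hasCounts_double h𝓘 N
  have hS := mem_powerset.1 S.2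
  have htop : ((intervalPoset n 𝓘 N).horizontalDouble n).rk ⊤ = n + 1 := hc.rank_eq
  rw [flagVector, GradedPoset.flagNumber_eq_card_chainsBelow hc.rank_eq hS,
    GradedPoset.card_chainsBelow_of_hasCounts (fun I hI => (h𝓘 I hI).1) hc S.1 ⊤ (fun t ht => by
      have := mem_Icc.1 (hS ht)
      omega), htop]
  push_cast
  congr 3
  refine filter_congr fun I hI => ?_
  have := h𝓘 I hI
  rw [and_iff_left_iff_imp]
  omega

theorem tendsto_normalizedDoubleVector {n : ℕ} {𝓘 : Finset (ℕ × ℕ)}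
    (h𝓘 : ∀ I ∈ 𝓘, 1 ≤ I.1 ∧ I.2 ≤ n) :
    Tendsto (fun N : ℕ+ => normalizedDoubleVector n 𝓘 N) atTop (𝓝 (rayVector n 𝓘)) := by
  refine tendsto_pi_nhds.2 fun S => ?_
  simp only [normalizedDoubleVector, flagVector_double h𝓘, rayVector, mul_div_assoc]
  refine Tendsto.const_mul _ ?_
  split_ifs with h
  · rw [filter_true_of_mem h]
    refine tendsto_const_nhds.congr fun N => ?_
    rw [div_self (pow_ne_zero _ (by exact_mod_cast N.ne_zero))]
  · have hlt : #{I ∈ 𝓘 | ∃ t ∈ S.1, I.1 ≤ t ∧ t ≤ I.2} < 𝓘.card := by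
      refine card_lt_card (filter_ssubset.2 ?_)
      simpa only [Meets, not_forall, exists_prop] using h
    have hN : Tendsto (fun N : ℕ+ => ((N : ℕ) : ℝ)) atTop atTop :=
      tendsto_natCast_atTop_atTop.comp tendsto_PNat_val_atTop_atTop
    have h0 := (tendsto_inv_atTop_zero.comp
      (tendsto_pow_atTop (α := ℝ) (Nat.sub_pos_of_lt hlt).ne')).comp hN
    refine h0.congr fun N => ?_
    have hN0 : ((N : ℕ) : ℝ) ≠ 0 := by exact_mod_cast N.ne_zero
    simp only [Function.comp_apply]
    rw [pow_sub₀ _ hN0 hlt.le, mul_inv, inv_inv, mul_comm, div_eq_mul_inv]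

theorem doubledLimitVector_eq {n : ℕ} {𝓘 : Finset (ℕ × ℕ)} (h𝓘 : ∀ I ∈ 𝓘, 1 ≤ I.1 ∧ I.2 ≤ n) :
    doubledLimitVector n 𝓘 = rayVector n 𝓘 := by
  funext S
  exact (tendsto_pi_nhds.1 (tendsto_normalizedDoubleVector h𝓘) S).limUnder_eq

theorem rayVector_mem_eulerianCone {n : ℕ} {𝓘 : Finset (ℕ × ℕ)} (h𝓘 : IsEvenIntervalSystem n 𝓘) :
    rayVector n 𝓘 ∈ eulerianCone n := by
  have hb : ∀ I ∈ 𝓘, 1 ≤ I.1 ∧ I.2 ≤ n := fun I hI => ⟨(h𝓘.1.1 I hI).1, (h𝓘.1.1 I hI).2.2⟩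
  refine PointedCone.mem_closure.2 (mem_closure_of_tendsto (tendsto_normalizedDoubleVector hb)
    (Eventually.of_forall fun N => ?_))
  have h1 : normalizedDoubleVector n 𝓘 N = (((N : ℕ) : ℝ) ^ 𝓘.card)⁻¹ •
      flagVector n ((intervalPoset n 𝓘 N).horizontalDouble n) := by
    funext S
    rw [normalizedDoubleVector, Pi.smul_apply, smul_eq_mul, div_eq_inv_mul]
  rw [h1]
  exact PointedCone.smul_mem _ (by positivity) (PointedCone.subset_hull
    ⟨_, (GradedPoset.hasCounts_double hb N).rank_eq, GradedPoset.isEulerian_double h𝓘 N, rfl⟩)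

/-! ### The span of the rays -/

theorem exists_isMaximalInterval {S : Finset ℕ} {x : ℕ} (hx : x ∈ S) :
    ∃ a b, IsMaximalInterval S a b ∧ a ≤ x ∧ x ≤ b := by
  have hne : ({I ∈ S ×ˢ S | I.1 ≤ x ∧ x ≤ I.2 ∧ Icc I.1 I.2 ⊆ S} : Finset (ℕ × ℕ)).Nonempty :=
    ⟨(x, x), by simp [hx]⟩
  obtain ⟨⟨a, b⟩, hI, hmax⟩ := exists_max_image _ (fun I => I.2 - I.1) hne
  simp only [mem_filter, mem_product, and_imp, Prod.forall] at hI hmax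
  obtain ⟨⟨haS, hbS⟩, hax, hxb, hsub⟩ := hI
  refine ⟨a, b, ⟨hax.trans hxb, hsub, fun c d hca hbd hcd => ?_⟩, hax, hxb⟩
  have h1 := hmax c d (hcd (mem_Icc.2 (by omega))) (hcd (mem_Icc.2 (by omega))) (by omega)
    (by omega) hcd
  omega

theorem IsMaximalInterval.eq_of_mem {S : Finset ℕ} {a b c d x : ℕ} (h : IsMaximalInterval S a b)
    (h' : IsMaximalInterval S c d) (hx : a ≤ x ∧ x ≤ b) (hx' : c ≤ x ∧ x ≤ d) :
    a = c ∧ b = d := by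
  have hsub : Icc (min a c) (max b d) ⊆ S := by
    intro t ht
    have ht := mem_Icc.1 ht
    by_cases h1 : a ≤ t ∧ t ≤ b
    · exact h.2.1 (mem_Icc.2 h1)
    · exact h'.2.1 (mem_Icc.2 (by omega))
  have h1 := h.2.2 _ _ (min_le_left a c) (le_max_left b d) hsub
  have h2 := h'.2.2 _ _ (min_le_right a c) (le_max_right b d) hsub
  omega

/-- The maximal intervals of `S`. -/
noncomputable def maximalIntervals (S : Finset ℕ) : Finset (ℕ × ℕ) :=
  open Classical in {I ∈ S ×ˢ S | IsMaximalInterval S I.1 I.2}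

theorem mem_maximalIntervals {S : Finset ℕ} {I : ℕ × ℕ} :
    I ∈ maximalIntervals S ↔ IsMaximalInterval S I.1 I.2 := by
  simp only [maximalIntervals, mem_filter, mem_product, and_iff_right_iff_imp]
  exact fun h => ⟨h.2.1 (mem_Icc.2 ⟨le_rfl, h.1⟩), h.2.1 (mem_Icc.2 ⟨h.1, le_rfl⟩)⟩

theorem IsEvenSet.isEvenIntervalSystem {n : ℕ} {Q : Finset ℕ} (hQ : IsEvenSet Q)
    (hQn : Q ⊆ Icc 1 n) {A : Finset (ℕ × ℕ)} (hA : A ⊆ maximalIntervals Q) :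
    IsEvenIntervalSystem n A := by
  have hmax : ∀ I ∈ A, IsMaximalInterval Q I.1 I.2 := fun I hI => mem_maximalIntervals.1 (hA hI)
  refine ⟨⟨fun I hI => ?_, fun I hI J hJ hne hsub => ?_⟩, fun I hI J hJ => ?_⟩
  · have h := hmax I hI
    have h1 := mem_Icc.1 (hQn (h.2.1 (mem_Icc.2 ⟨le_rfl, h.1⟩)))
    have h2 := mem_Icc.1 (hQn (h.2.1 (mem_Icc.2 ⟨h.1, le_rfl⟩)))
    exact ⟨h1.1, h.1, h2.2⟩
  · have h := hmax I hI
    have h1 := mem_Icc.1 (hsub (mem_Icc.2 ⟨le_rfl, h.1⟩))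
    have h2 := h.eq_of_mem (hmax J hJ) ⟨le_rfl, h.1⟩ h1
    exact hne (Prod.ext h2.1 h2.2)
  · by_cases hne : I = J
    · rw [hne, inter_self]
      exact hQ _ _ (hmax J hJ)
    · have h : Icc I.1 I.2 ∩ Icc J.1 J.2 = ∅ := by
        refine eq_empty_of_forall_notMem fun t ht => hne ?_
        have ht := mem_inter.1 ht
        have h2 := (hmax I hI).eq_of_mem (hmax J hJ) (mem_Icc.1 ht.1) (mem_Icc.1 ht.2)
        exact Prod.ext h2.1 h2.2
      simp [h]

/-- By inclusion-exclusion over the maximal intervals of an even set `Q`, the flag vector whose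
only nonzero `L`-entry is `L_Q = 1` is a combination of ray vectors. -/
theorem disjointVector_eq_sum (n : ℕ) (Q : Finset ℕ) :
    (fun T => 2 ^ T.1.card * if Disjoint Q T.1 then 1 else 0 : FlagSpace n) =
      ∑ A ∈ (maximalIntervals Q).powerset, (-1 : ℝ) ^ A.card • rayVector n A := by
  funext T
  set F : Finset (ℕ × ℕ) := {I ∈ maximalIntervals Q | ∃ t ∈ T.1, I.1 ≤ t ∧ t ≤ I.2} with hF
  have h1 : (∑ A ∈ (maximalIntervals Q).powerset, (-1 : ℝ) ^ A.card • rayVector n A) T =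
      2 ^ T.1.card * ∑ A ∈ F.powerset, (-1 : ℝ) ^ A.card := by
    have h2 : F.powerset = {A ∈ (maximalIntervals Q).powerset | Meets T.1 A} := by
      ext A
      rw [Finset.mem_filter, mem_powerset, mem_powerset]
      simp only [hF, subset_iff, Finset.mem_filter]
      exact ⟨fun h => ⟨fun I hI => (h hI).1, fun I hI => (h hI).2⟩,
        fun h I hI => ⟨h.1 hI, h.2 I hI⟩⟩
    rw [h2, sum_filter, mul_sum, Finset.sum_apply]
    refine sum_congr rfl fun A _ => ?_
    simp only [rayVector, Pi.smul_apply, smul_eq_mul]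
    split_ifs <;> ring
  have h3 : ∑ A ∈ F.powerset, (-1 : ℝ) ^ A.card = if F = ∅ then 1 else 0 := by
    exact_mod_cast congrArg (Int.cast : ℤ → ℝ) (sum_powerset_neg_one_pow_card (x := F))
  have h4 : F = ∅ ↔ Disjoint Q T.1 := by
    constructor
    · intro h
      refine disjoint_left.2 fun x hxQ hxT => ?_
      obtain ⟨a, b, hab, hx⟩ := exists_isMaximalInterval hxQ
      exact notMem_empty (a, b)
        (h ▸ mem_filter.2 ⟨mem_maximalIntervals.2 hab, x, hxT, hx⟩)
    · intro h
      refine eq_empty_of_forall_notMem fun I hI => ?_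
      obtain ⟨hI, t, ht, htI⟩ := mem_filter.1 hI
      exact disjoint_left.1 h ((mem_maximalIntervals.1 hI).2.1 (mem_Icc.2 htI)) ht
  rw [h1, h3]
  simp only [h4]

theorem mem_span_rayVector {n : ℕ} {v : FlagSpace n}
    (hv : ∀ Q ⊆ Icc 1 n, ¬ IsEvenSet Q → LForm n Q v = 0) :
    v ∈ Submodule.span ℝ (rayVector n '' {𝓘 | IsEvenIntervalSystem n 𝓘}) := by
  have h1 : v = ∑ Q ∈ (Icc 1 n).powerset, LForm n Q v •
      (fun T => 2 ^ T.1.card * if Disjoint Q T.1 then 1 else 0 : FlagSpace n) := by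
    funext T
    have h2 := sum_LForm_eq_apply v T
    have h3 : (Icc 1 n \ T.1).powerset = {Q ∈ (Icc 1 n).powerset | Disjoint Q T.1} := by
      ext Q
      simp only [mem_powerset, mem_filter, subset_sdiff]
    rw [h3, sum_filter] at h2
    rw [Finset.sum_apply]
    have h4 : v T = 2 ^ T.1.card * ((1 / 2) ^ T.1.card * v T) := by
      rw [← mul_assoc, ← mul_pow]
      norm_num
    rw [h4, ← h2, mul_sum]
    refine sum_congr rfl fun Q _ => ?_
    simp only [Pi.smul_apply, smul_eq_mul]
    split_ifs <;> ring
  rw [h1]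
  refine Submodule.sum_mem _ fun Q hQ => ?_
  have hQ := mem_powerset.1 hQ
  by_cases hev : IsEvenSet Q
  · rw [disjointVector_eq_sum]
    exact Submodule.smul_mem _ _ (Submodule.sum_mem _ fun A hA => Submodule.smul_mem _ _
      (Submodule.subset_span ⟨A, hev.isEvenIntervalSystem hQ (mem_powerset.1 hA), rfl⟩))
  · rw [hv Q hQ hev, zero_smul]
    exact Submodule.zero_mem _

/-- The value of `facetForm n M V` at the flag vector of `D P(n, 𝓘)`. -/
def incidence (n : ℕ) (M V : Finset ℕ) (𝓘 : Finset (ℕ × ℕ)) : ℤ :=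
  (-1) ^ (M.card / 2) *
    ∑ K ∈ M.powerset, (-1) ^ K.card * if Meets (Icc 1 n \ V ∪ K) 𝓘 then 1 else 0

theorem facetForm_rayVector {n : ℕ} {M V : Finset ℕ} (hM : M ⊆ V) (hV : V ⊆ Icc 1 n)
    (𝓘 : Finset (ℕ × ℕ)) : facetForm n M V (rayVector n 𝓘) = incidence n M V 𝓘 := by
  rw [facetForm_apply hM hV, incidence]
  push_cast
  congr 1
  -- the coefficient of `[T meets 𝓘]`
  have h1 : ∀ T ⊆ Icc 1 n, ((∏ j ∈ Icc 1 n, if j ∈ T then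
      (if j ∈ M then -1 / 2 else if j ∈ V then 0 else 1 / 2) else if j ∈ V then 1 else 0 : ℝ) *
      2 ^ T.card) = ∏ j ∈ Icc 1 n, if j ∈ T then
      (if j ∈ M then -1 else if j ∈ V then 0 else 1) else if j ∈ V then 1 else 0 := by
    intro T hT
    have h2 : (2 : ℝ) ^ T.card = ∏ j ∈ Icc 1 n, if j ∈ T then 2 else 1 := by
      rw [prod_ite_mem, inter_eq_right.2 hT, prod_const]
    rw [h2, ← prod_mul_distrib]
    refine prod_congr rfl fun j _ => ?_
    split_ifs <;> norm_num
  have h2 : weightedSum n (fun j => if j ∈ V then 1 else 0)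
      (fun j => if j ∈ M then -1 / 2 else if j ∈ V then 0 else 1 / 2) (rayVector n 𝓘) =
      ∑ T ∈ (Icc 1 n).powerset, (∏ j ∈ Icc 1 n, if j ∈ T then
      (if j ∈ M then -1 else if j ∈ V then 0 else 1) else if j ∈ V then 1 else 0) *
      (if Meets T 𝓘 then 1 else 0 : ℝ) := by
    rw [weightedSum, ← sum_coe_sort (Icc 1 n).powerset]
    refine sum_congr rfl fun T _ => ?_
    rw [← h1 T.1 (mem_powerset.1 T.2), rayVector, mul_assoc]
  have hKV : ∀ K ∈ M.powerset, (Icc 1 n \ V ∪ K) ∩ V = K := by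
    intro K hK
    have hK := mem_powerset.1 hK
    rw [union_inter_distrib_right, sdiff_inter_self, empty_union, inter_eq_left.2 (hK.trans hM)]
  rw [h2, ← sum_subset (s₁ := M.powerset.image fun K => Icc 1 n \ V ∪ K), sum_image]
  · refine sum_congr rfl fun K hK => ?_
    have hK' := mem_powerset.1 hK
    congr 1
    rw [← prod_const, ← inter_eq_right.2 (hK'.trans (hM.trans hV)), ← prod_ite_mem]
    refine prod_congr rfl fun j hj => ?_
    have h3 := @hK' j
    have h4 := @hM j
    by_cases h5 : j ∈ K <;> by_cases h6 : j ∈ M <;> by_cases h7 : j ∈ V <;>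
      simp_all
  · intro K hK K' hK' h
    rw [← hKV K hK, ← hKV K' hK']
    exact congrArg (· ∩ V) h
  · intro T hT
    obtain ⟨K, hK, rfl⟩ := mem_image.1 hT
    exact mem_powerset.2 (union_subset sdiff_subset ((mem_powerset.1 hK).trans (hM.trans hV)))
  · -- the weight of `T` vanishes unless `T` is the complement of `V` together with a part of `M`
    intro T hT hT'
    have hT := mem_powerset.1 hT
    have h3 : ∃ j ∈ Icc 1 n, (j ∉ V ∧ j ∉ T) ∨ (j ∈ T ∧ j ∈ V ∧ j ∉ M) := by
      by_contra! hcon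
      refine hT' (mem_image.2 ⟨T ∩ M, mem_powerset.2 inter_subset_right, ?_⟩)
      ext j
      have h4 := @hT j
      have h5 := hcon j
      have h6 := @hM j
      simp only [mem_union, Finset.mem_sdiff, mem_inter]
      tauto
    obtain ⟨j, hj, h4⟩ := h3
    rw [prod_eq_zero hj, zero_mul]
    rcases h4 with h4 | h4 <;> simp [h4]

/-! ### Cones over polytopes with `0`-`1` incidence matrices -/

section Polyhedral

variable {E ι : Type*} [AddCommGroup E] [Module ℝ E] [DecidableEq ι]

/-- The cone `C` is generated by the vectors `r j`, `j ∈ J`, and cut out of their span by the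
inequalities `φ ≥ 0`, `φ ∈ Φ`; moreover `φ (r j)` is `1` if `j ∈ supp φ` and `0` otherwise. -/
structure IsDualPair (C : PointedCone ℝ E) (J : Finset ι) (r : ι → E) (Φ : Set (E →ₗ[ℝ] ℝ))
    (supp : (E →ₗ[ℝ] ℝ) → Finset ι) : Prop where
  eq_hull : C = PointedCone.hull ℝ (r '' J)
  supp_subset : ∀ φ ∈ Φ, supp φ ⊆ J
  apply_eq : ∀ φ ∈ Φ, ∀ j ∈ J, φ (r j) = if j ∈ supp φ then 1 else 0
  mem_of_nonneg : ∀ v ∈ Submodule.span ℝ (r '' J), (∀ φ ∈ Φ, 0 ≤ φ v) → v ∈ C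

theorem mem_hull_image_iff {J : Finset ι} {r : ι → E} {v : E} :
    v ∈ PointedCone.hull ℝ (r '' J) ↔ ∃ c : ι → ℝ, (∀ j, 0 ≤ c j) ∧ v = ∑ j ∈ J, c j • r j := by
  constructor
  · intro h
    obtain ⟨c, rfl⟩ := (Submodule.mem_span_image_finset_iff_exists_fun _).1 h
    refine ⟨fun j => if hj : j ∈ J then c ⟨j, hj⟩ else 0, fun j => ?_, ?_⟩
    · dsimp only
      split_ifs with hj
      · exact (c ⟨j, hj⟩).2
      · exact le_rfl
    · rw [← sum_coe_sort J]
      refine sum_congr rfl fun j _ => ?_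
      dsimp only
      rw [dif_pos j.2]
      rfl
  · rintro ⟨c, hc, rfl⟩
    exact Submodule.sum_mem _ fun j hj => PointedCone.smul_mem _ (hc j)
      (PointedCone.subset_hull ⟨j, hj, rfl⟩)

namespace IsDualPair

variable {C : PointedCone ℝ E} {J : Finset ι} {r : ι → E} {Φ : Set (E →ₗ[ℝ] ℝ)}
  {supp : (E →ₗ[ℝ] ℝ) → Finset ι}

theorem mem_iff (h : IsDualPair C J r Φ supp) {v : E} :
    v ∈ C ↔ ∃ c : ι → ℝ, (∀ j, 0 ≤ c j) ∧ v = ∑ j ∈ J, c j • r j := by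
  rw [h.eq_hull, mem_hull_image_iff]

theorem mem (h : IsDualPair C J r Φ supp) {j : ι} (hj : j ∈ J) : r j ∈ C := by
  rw [h.eq_hull]
  exact PointedCone.subset_hull ⟨j, hj, rfl⟩

theorem fg (h : IsDualPair C J r Φ supp) : C.FG := by
  classical
  refine ⟨J.image r, ?_⟩
  rw [coe_image, h.eq_hull]

theorem span_eq (h : IsDualPair C J r Φ supp) :
    Submodule.span ℝ (C : Set E) = Submodule.span ℝ (r '' J) := by
  refine le_antisymm (Submodule.span_le.2 fun v hv => ?_) (Submodule.span_mono ?_)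
  · obtain ⟨c, -, rfl⟩ := h.mem_iff.1 hv
    exact Submodule.sum_mem _ fun j hj => Submodule.smul_mem _ _ (Submodule.subset_span ⟨j, hj, rfl⟩)
  · rintro _ ⟨j, hj, rfl⟩
    exact h.mem hj

theorem apply_sum (h : IsDualPair C J r Φ supp) {φ : E →ₗ[ℝ] ℝ} (hφ : φ ∈ Φ) (c : ι → ℝ) :
    φ (∑ j ∈ J, c j • r j) = ∑ j ∈ supp φ, c j := by
  have h1 : ∀ j ∈ J, φ (c j • r j) = if j ∈ supp φ then c j else 0 := fun j hj => by
    rw [map_smul, h.apply_eq φ hφ j hj, smul_eq_mul, mul_ite, mul_one, mul_zero]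
  rw [map_sum, sum_congr rfl h1, sum_ite_mem, inter_eq_right.2 (h.supp_subset φ hφ)]

theorem nonneg (h : IsDualPair C J r Φ supp) {φ : E →ₗ[ℝ] ℝ} (hφ : φ ∈ Φ) {v : E} (hv : v ∈ C) :
    0 ≤ φ v := by
  obtain ⟨c, hc, rfl⟩ := h.mem_iff.1 hv
  rw [h.apply_sum hφ]
  exact sum_nonneg fun j _ => hc j

/-! ### Extreme rays -/

/-- The generators span extreme rays if any two of them are separated by one of the
inequalities. -/
theorem isExtremeRay (h : IsDualPair C J r Φ supp)
    (hsep : ∀ i ∈ J, ∀ j ∈ J, i ≠ j → ∃ φ ∈ Φ, i ∉ supp φ ∧ j ∈ supp φ) {i : ι} (hi : i ∈ J)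
    (hi0 : r i ≠ 0) : IsExtremeRay C (PointedCone.hull ℝ {r i}) := by
  refine ⟨PointedCone.IsFaceOf.of_mem_of_add_mem_left ?_ ?_, r i, hi0, rfl⟩
  · exact Submodule.span_le.2 (Set.singleton_subset_iff.2 (h.mem hi))
  · intro x y hx hy hxy
    obtain ⟨c, hc, rfl⟩ := h.mem_iff.1 hx
    have h1 : ∀ j ∈ J, j ≠ i → c j = 0 := by
      intro j hj hji
      obtain ⟨φ, hφ, hiφ, hjφ⟩ := hsep i hi j hj hji.symm
      obtain ⟨t, ht⟩ := Submodule.mem_span_singleton.1 hxy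
      have h2 : φ (∑ j ∈ J, c j • r j) + φ y = 0 := by
        rw [← map_add, ← ht]
        change φ ((t : ℝ) • r i) = 0
        rw [map_smul, h.apply_eq φ hφ i hi, if_neg hiφ, smul_zero]
      have h3 := h.nonneg hφ hy
      rw [h.apply_sum hφ] at h2
      have h4 := single_le_sum (fun j _ => hc j) hjφ
      exact le_antisymm (by linarith) (hc j)
    rw [sum_eq_single_of_mem i hi fun j hj hji => by rw [h1 j hj hji, zero_smul]]
    exact PointedCone.smul_mem _ (hc i) (PointedCone.subset_hull rfl)

theorem eq_hull_of_isExtremeRay (h : IsDualPair C J r Φ supp) (h0 : ∀ j ∈ J, r j ≠ 0)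
    {R : PointedCone ℝ E} (hR : IsExtremeRay C R) :
    ∃ j ∈ J, R = PointedCone.hull ℝ {r j} := by
  obtain ⟨hface, v, hv, rfl⟩ := hR
  have hvR : v ∈ PointedCone.hull ℝ {v} := PointedCone.subset_hull rfl
  obtain ⟨c, hc, hcv⟩ := h.mem_iff.1 (hface.le hvR)
  obtain ⟨j, hj, hj0⟩ : ∃ j ∈ J, c j ≠ 0 := by
    by_contra! hcon
    exact hv (hcv.trans (sum_eq_zero fun j hj => by rw [hcon j hj, zero_smul]))
  have hcj : 0 < c j := lt_of_le_of_ne (hc j) hj0.symm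
  have hrj : r j ∈ PointedCone.hull ℝ {v} := by
    refine hface.mem_of_smul_add_mem (y := ∑ k ∈ J.erase j, c k • r k) (h.mem hj)
      (Submodule.sum_mem _ fun k hk => PointedCone.smul_mem _ (hc k) (h.mem (mem_of_mem_erase hk)))
      hcj ?_
    rw [add_sum_erase _ (fun k => c k • r k) hj, ← hcv]
    exact hvR
  refine ⟨j, hj, le_antisymm ?_ (Submodule.span_le.2 (Set.singleton_subset_iff.2 hrj))⟩
  obtain ⟨t, ht⟩ := Submodule.mem_span_singleton.1 hrj
  have ht' : (t : ℝ) • v = r j := ht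
  have ht0 : (t : ℝ) ≠ 0 := fun h0' => h0 j hj (by rw [← ht', h0', zero_smul])
  refine Submodule.span_le.2 (Set.singleton_subset_iff.2 ?_)
  have h1 : v = (t : ℝ)⁻¹ • r j := by rw [← ht', smul_smul, inv_mul_cancel₀ ht0, one_smul]
  rw [h1]
  exact PointedCone.smul_mem _ (inv_nonneg.2 t.2) (PointedCone.subset_hull rfl)

theorem injOn_hull_singleton (h : IsDualPair C J r Φ supp)
    (hsep : ∀ i ∈ J, ∀ j ∈ J, i ≠ j → ∃ φ ∈ Φ, i ∉ supp φ ∧ j ∈ supp φ) :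
    Set.InjOn (fun j => PointedCone.hull ℝ {r j}) (J : Set ι) := by
  intro i hi j hj hij
  by_contra hne
  obtain ⟨φ, hφ, hiφ, hjφ⟩ := hsep i hi j hj hne
  have h1 : r j ∈ PointedCone.hull ℝ {r i} := by
    have h2 : r j ∈ PointedCone.hull ℝ {r j} := PointedCone.subset_hull rfl
    exact (show PointedCone.hull ℝ {r i} = PointedCone.hull ℝ {r j} from hij) ▸ h2
  obtain ⟨t, ht⟩ := Submodule.mem_span_singleton.1 h1
  have ht' : (t : ℝ) • r i = r j := ht
  have h2 := h.apply_eq φ hφ j hj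
  rw [← ht', map_smul, h.apply_eq φ hφ i hi, if_neg hiφ, if_pos hjφ, smul_zero] at h2
  exact zero_ne_one h2

/-! ### Facets -/

/-- The face on which the form `φ` vanishes. -/
def kerFace (C : PointedCone ℝ E) (φ : E →ₗ[ℝ] ℝ) : PointedCone ℝ E :=
  C ⊓ PointedCone.ofSubmodule (LinearMap.ker φ)

theorem mem_kerFace {φ : E →ₗ[ℝ] ℝ} {v : E} : v ∈ kerFace C φ ↔ v ∈ C ∧ φ v = 0 := Iff.rfl

theorem isFaceOf_kerFace (h : IsDualPair C J r Φ supp) {φ : E →ₗ[ℝ] ℝ} (hφ : φ ∈ Φ) :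
    (kerFace C φ).IsFaceOf C := by
  refine PointedCone.IsFaceOf.of_mem_of_add_mem_left inf_le_left fun {x y} hx hy hxy => ?_
  have h1 := (mem_kerFace.1 hxy).2
  rw [map_add] at h1
  have h2 := h.nonneg hφ hx
  have h3 := h.nonneg hφ hy
  exact mem_kerFace.2 ⟨hx, by linarith⟩

/-- If the generators outside of `ker φ` are congruent modulo the span of the generators in
`ker φ`, then `φ` defines a facet. -/
theorem isFacet_kerFace [FiniteDimensional ℝ E] (h : IsDualPair C J r Φ supp) {φ : E →ₗ[ℝ] ℝ}
    (hφ : φ ∈ Φ) (hcong : ∃ i ∈ supp φ, ∀ j ∈ supp φ,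
      r j - r i ∈ Submodule.span ℝ (r '' (J \ supp φ : Finset ι))) :
    IsFacet C (kerFace C φ) := by
  refine ⟨h.isFaceOf_kerFace hφ, ?_⟩
  obtain ⟨i, hi, hcong⟩ := hcong
  have hiJ := h.supp_subset φ hφ hi
  set F := Submodule.span ℝ (kerFace C φ : Set E) with hF
  have hφi : φ (r i) = 1 := by rw [h.apply_eq φ hφ i hiJ, if_pos hi]
  have hsub : Submodule.span ℝ (r '' (J \ supp φ : Finset ι)) ≤ F := by
    refine Submodule.span_mono ?_
    rintro _ ⟨j, hj, rfl⟩
    have hj := Finset.mem_sdiff.1 (mem_coe.1 hj)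
    exact mem_kerFace.2 ⟨h.mem hj.1, by rw [h.apply_eq φ hφ j hj.1, if_neg hj.2]⟩
  have hker : F ≤ LinearMap.ker φ := Submodule.span_le.2 fun v hv => (mem_kerFace.1 hv).2
  have hsup : F ⊔ Submodule.span ℝ {r i} = Submodule.span ℝ (C : Set E) := by
    refine le_antisymm (sup_le (Submodule.span_mono fun v hv => (mem_kerFace.1 hv).1)
      (Submodule.span_mono (Set.singleton_subset_iff.2 (h.mem hiJ)))) ?_
    rw [h.span_eq]
    refine Submodule.span_le.2 ?_
    rintro _ ⟨j, hj, rfl⟩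
    by_cases hjφ : j ∈ supp φ
    · have h1 : r j = (r j - r i) + r i := by abel
      rw [h1]
      exact Submodule.add_mem _ (Submodule.mem_sup_left (hsub (hcong j hjφ)))
        (Submodule.mem_sup_right (Submodule.mem_span_singleton_self _))
    · exact Submodule.mem_sup_left (hsub (Submodule.subset_span
        ⟨j, mem_coe.2 (Finset.mem_sdiff.2 ⟨hj, hjφ⟩), rfl⟩))
  have hinf : F ⊓ Submodule.span ℝ {r i} = ⊥ := by
    refine (Submodule.eq_bot_iff _).2 fun v hv => ?_
    obtain ⟨t, rfl⟩ := Submodule.mem_span_singleton.1 hv.2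
    have h1 : φ (t • r i) = 0 := hker hv.1
    rw [map_smul, hφi, smul_eq_mul, mul_one] at h1
    rw [h1, zero_smul]
  have hri : r i ≠ 0 := fun h0 => by rw [h0, map_zero] at hφi; exact zero_ne_one hφi
  have h1 := Submodule.finrank_sup_add_finrank_inf_eq F (Submodule.span ℝ {r i})
  rw [hsup, hinf, finrank_bot, add_zero, finrank_span_singleton hri] at h1
  exact h1.symm

/-- A face is cut out of the cone by its linear span. -/
theorem mem_of_mem_span {C F : PointedCone ℝ E} (hF : F.IsFaceOf C) {v : E} (hv : v ∈ C)
    (hvF : v ∈ Submodule.span ℝ (F : Set E)) : v ∈ F := by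
  have key : ∃ f ∈ F, ∃ g ∈ F, v = f - g := by
    clear hv
    induction hvF using Submodule.span_induction with
    | mem x hx => exact ⟨x, hx, 0, F.zero_mem, by simp⟩
    | zero => exact ⟨0, F.zero_mem, 0, F.zero_mem, by simp⟩
    | add x y _ _ hx hy =>
      obtain ⟨f, hf, g, hg, rfl⟩ := hx
      obtain ⟨f', hf', g', hg', rfl⟩ := hy
      exact ⟨f + f', F.add_mem hf hf', g + g', F.add_mem hg hg', by abel⟩
    | smul a x _ hx =>
      obtain ⟨f, hf, g, hg, rfl⟩ := hx
      rcases le_total 0 a with ha | ha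
      · exact ⟨a • f, PointedCone.smul_mem _ ha hf, a • g, PointedCone.smul_mem _ ha hg,
          smul_sub _ _ _⟩
      · refine ⟨(-a) • g, PointedCone.smul_mem _ (neg_nonneg.2 ha) hg, (-a) • f,
          PointedCone.smul_mem _ (neg_nonneg.2 ha) hf, ?_⟩
        rw [smul_sub, neg_smul, neg_smul]
        abel
  obtain ⟨f, hf, g, hg, hfg⟩ := key
  refine hF.mem_of_add_mem_left hv (hF.le hg) ?_
  rw [hfg, sub_add_cancel]
  exact hf

/-- Every facet is the zero set of one of the inequalities: otherwise the sum of the generators in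
the facet would be positive under all of them, hence in the interior of the cone. -/
theorem eq_kerFace_of_isFacet [FiniteDimensional ℝ E] (h : IsDualPair C J r Φ supp)
    (hfac : ∀ φ ∈ Φ, IsFacet C (kerFace C φ)) {F : PointedCone ℝ E} (hF : IsFacet C F) :
    ∃ φ ∈ Φ, F = kerFace C φ := by
  classical
  obtain ⟨φ, hφ, hφF⟩ : ∃ φ ∈ Φ, ∀ j ∈ J, r j ∈ F → j ∉ supp φ := by
    by_contra! hcon
    have hp : ∑ j ∈ J with r j ∈ F, r j ∈ F :=
      Submodule.sum_mem _ fun j hj => (mem_filter.1 hj).2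
    have hall : ∀ i ∈ J, r i ∈ F := by
      intro i hi
      refine hF.1.mem_of_add_mem_left (h.mem hi)
        (y := ∑ j ∈ J with r j ∈ F, r j - r i) (h.mem_of_nonneg _ ?_ fun φ hφ => ?_) ?_
      · exact Submodule.sub_mem _ (Submodule.sum_mem _ fun j hj =>
          Submodule.subset_span ⟨j, (mem_filter.1 hj).1, rfl⟩) (Submodule.subset_span ⟨i, hi, rfl⟩)
      · obtain ⟨k, hk, hkF, hkφ⟩ := hcon φ hφ
        have h1 : φ (r k) ≤ ∑ j ∈ J with r j ∈ F, φ (r j) :=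
          single_le_sum (f := fun j => φ (r j))
            (fun j hj => h.nonneg hφ (h.mem (mem_filter.1 hj).1)) (mem_filter.2 ⟨hk, hkF⟩)
        rw [map_sub, map_sum]
        rw [h.apply_eq φ hφ k hk, if_pos hkφ] at h1
        rw [h.apply_eq φ hφ i hi]
        split_ifs <;> linarith
      · rw [add_sub_cancel]
        exact hp
    have hCF : C = F := by
      refine le_antisymm ?_ hF.1.le
      rw [h.eq_hull]
      refine Submodule.span_le.2 ?_
      rintro _ ⟨j, hj, rfl⟩
      exact hall j hj
    have := hF.2
    rw [← hCF] at this
    omega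
  have hle : F ≤ kerFace C φ := by
    intro v hv
    have hvC := hF.1.le hv
    obtain ⟨c, hc, hcv⟩ := h.mem_iff.1 hvC
    refine mem_kerFace.2 ⟨hvC, ?_⟩
    rw [hcv, h.apply_sum hφ]
    refine sum_eq_zero fun j hj => ?_
    have hjJ := h.supp_subset φ hφ hj
    by_contra hj0
    refine hφF j hjJ ?_ hj
    rw [hcv, ← add_sum_erase _ _ hjJ] at hv
    exact hF.1.mem_of_smul_add_mem (h.mem hjJ)
      (Submodule.sum_mem _ fun k hk => PointedCone.smul_mem _ (hc k) (h.mem (mem_of_mem_erase hk)))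
      (lt_of_le_of_ne (hc j) (Ne.symm hj0)) hv
  have hspan : Submodule.span ℝ (F : Set E) = Submodule.span ℝ (kerFace C φ : Set E) := by
    refine Submodule.eq_of_le_of_finrank_eq (Submodule.span_mono hle) ?_
    have h1 := hF.2
    have h2 := (hfac φ hφ).2
    omega
  refine ⟨φ, hφ, le_antisymm hle fun v hv => ?_⟩
  exact mem_of_mem_span hF.1 (mem_kerFace.1 hv).1 (hspan ▸ Submodule.subset_span hv)

theorem kerFace_eq_iff (h : IsDualPair C J r Φ supp) {φ ψ : E →ₗ[ℝ] ℝ} (hφ : φ ∈ Φ) (hψ : ψ ∈ Φ) :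
    kerFace C φ = kerFace C ψ ↔ supp φ = supp ψ := by
  have h1 : ∀ {φ}, φ ∈ Φ → ∀ j ∈ J, (r j ∈ kerFace C φ ↔ j ∉ supp φ) := by
    intro φ hφ j hj
    rw [mem_kerFace, and_iff_right (h.mem hj), h.apply_eq φ hφ j hj]
    split_ifs with hjφ <;> simp [hjφ]
  constructor
  · intro heq
    ext j
    by_cases hj : j ∈ J
    · rw [← not_iff_not, ← h1 hφ j hj, ← h1 hψ j hj, heq]
    · exact iff_of_false (fun h2 => hj (h.supp_subset φ hφ h2))
        fun h2 => hj (h.supp_subset ψ hψ h2)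
  · intro heq
    ext v
    rw [mem_kerFace, mem_kerFace, and_congr_right_iff]
    intro hv
    obtain ⟨c, -, rfl⟩ := h.mem_iff.1 hv
    rw [h.apply_sum hφ, h.apply_sum hψ, heq]

theorem ncard_kerFace (h : IsDualPair C J r Φ supp) :
    {F | ∃ φ ∈ Φ, F = kerFace C φ}.ncard = (supp '' Φ).ncard := by
  have h1 : {F | ∃ φ ∈ Φ, F = kerFace C φ} = kerFace C '' Φ := by
    ext F
    exact ⟨fun ⟨φ, hφ, hF⟩ => ⟨φ, hφ, hF.symm⟩, fun ⟨φ, hφ, hF⟩ => ⟨φ, hφ, hF.symm⟩⟩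
  rw [h1]
  -- sending the support of a form to its face is well defined and injective
  obtain ⟨g, hg⟩ : ∃ g : Finset ι → PointedCone ℝ E, ∀ φ ∈ Φ, g (supp φ) = kerFace C φ := by
    classical
    refine ⟨fun S => if hS : ∃ φ ∈ Φ, supp φ = S then kerFace C hS.choose else ⊥, fun φ hφ => ?_⟩
    have hS : ∃ ψ ∈ Φ, supp ψ = supp φ := ⟨φ, hφ, rfl⟩
    dsimp only
    rw [dif_pos hS]
    exact (h.kerFace_eq_iff hS.choose_spec.1 hφ).2 hS.choose_spec.2
  have h2 : kerFace C '' Φ = g '' (supp '' Φ) := by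
    rw [Set.image_image]
    exact Set.image_congr fun φ hφ => (hg φ hφ).symm
  rw [h2, Set.InjOn.ncard_image]
  rintro _ ⟨φ, hφ, rfl⟩ _ ⟨ψ, hψ, rfl⟩ heq
  rw [hg φ hφ, hg ψ hψ] at heq
  exact (h.kerFace_eq_iff hφ hψ).1 heq

end IsDualPair

end Polyhedral

/-! ### Enumeration of the rays and facets in low rank -/

instance (S : Finset ℕ) (a b : ℕ) : Decidable (IsMaximalInterval S a b) :=
  decidable_of_iff _ isMaximalInterval_iff.symm

theorem IsMaximalInterval.left_mem {S : Finset ℕ} {a b : ℕ} (h : IsMaximalInterval S a b) :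
    a ∈ S := h.2.1 (mem_Icc.2 ⟨le_rfl, h.1⟩)

theorem IsMaximalInterval.right_mem {S : Finset ℕ} {a b : ℕ} (h : IsMaximalInterval S a b) :
    b ∈ S := h.2.1 (mem_Icc.2 ⟨h.1, le_rfl⟩)

theorem forall_isMaximalInterval_iff {S : Finset ℕ} {p : ℕ → ℕ → Prop} :
    (∀ a b, IsMaximalInterval S a b → p a b) ↔
      ∀ a ∈ S, ∀ b ∈ S, IsMaximalInterval S a b → p a b :=
  ⟨fun h a _ b _ => h a b, fun h a b hab => h a hab.left_mem b hab.right_mem hab⟩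

theorem isFacetPair_iff {n : ℕ} {M V : Finset ℕ} : IsFacetPair n M V ↔
    V ⊆ Icc 1 n ∧ M ⊆ V ∧
    (∀ a ∈ V, ∀ b ∈ V, IsMaximalInterval V a b → 2 ≤ (Icc a b).card ∧
      (M ∩ Icc a b = ∅ ∨ M ∩ Icc a b = Icc a (a + 1) ∨ M ∩ Icc a b = Icc (b - 1) b) ∧
      (a ∉ M → a = 1 ∨ ∃ m ∈ M, m + 2 = a) ∧ (b ∉ M → b = n ∨ b + 2 ∈ M)) ∧
    ∀ a ∈ Icc 0 (n + 1) \ V, ∀ b ∈ Icc 0 (n + 1) \ V,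
      IsMaximalInterval (Icc 0 (n + 1) \ V) a b → (Icc a b).card ≤ 3 := by
  rw [← forall_isMaximalInterval_iff, ← forall_isMaximalInterval_iff]
  constructor
  · intro h
    exact ⟨h.subset, h.subset', fun a b hab => ⟨h.two_le a b hab, h.inter a b hab,
      h.left a b hab, h.right a b hab⟩, h.le_three⟩
  · rintro ⟨h1, h2, h3, h4⟩
    exact ⟨h1, fun a b h => (h3 a b h).1, h4, h2, fun a b h => (h3 a b h).2.1,
      fun a b h => (h3 a b h).2.2.1, fun a b h => (h3 a b h).2.2.2⟩

set_option synthInstance.maxSize 1000 in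
set_option synthInstance.maxHeartbeats 400000 in
instance (n : ℕ) (M V : Finset ℕ) : Decidable (IsFacetPair n M V) :=
  decidable_of_iff _ isFacetPair_iff.symm

instance (n : ℕ) (𝓘 : Finset (ℕ × ℕ)) : Decidable (IsEvenIntervalSystem n 𝓘) := by
  unfold IsEvenIntervalSystem IsIntervalSystem
  infer_instance

/-- The even interval systems on `[1, n]`. -/
def evenSystems (n : ℕ) : Finset (Finset (ℕ × ℕ)) :=
  {𝓘 ∈ ({I ∈ Icc 1 n ×ˢ Icc 1 n | I.1 ≤ I.2 ∧ Even (Icc I.1 I.2).card} :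
    Finset (ℕ × ℕ)).powerset | IsEvenIntervalSystem n 𝓘}

theorem mem_evenSystems {n : ℕ} {𝓘 : Finset (ℕ × ℕ)} :
    𝓘 ∈ evenSystems n ↔ IsEvenIntervalSystem n 𝓘 := by
  simp only [evenSystems, mem_filter, mem_powerset, and_iff_right_iff_imp]
  intro h I hI
  have h1 := h.1.1 I hI
  have h2 := h.2 I hI I hI
  rw [inter_self] at h2
  simp only [mem_filter, mem_product, mem_Icc]
  exact ⟨⟨⟨h1.1, by omega⟩, by omega, h1.2.2⟩, h1.2.1, h2⟩

/-- The pairs `(M, V)` for which `facetForm n M V` is one of the forms considered; the pair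
`(∅, [1, n])` stands for the sum of all the entries of the `L`-vector. -/
def facetPairs (n : ℕ) : Finset (Finset ℕ × Finset ℕ) :=
  insert (∅, Icc 1 n) {p ∈ (Icc 1 n).powerset ×ˢ (Icc 1 n).powerset | IsFacetPair n p.1 p.2}

/-- The even interval systems at which `facetForm n M V` does not vanish. -/
def facetSupport (n : ℕ) (p : Finset ℕ × Finset ℕ) : Finset (Finset (ℕ × ℕ)) :=
  {𝓘 ∈ evenSystems n | incidence n p.1 p.2 𝓘 ≠ 0}

/-- Four interval systems inside `[s, s + 3]`, in cyclic order: they are the vertices of a square,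
as the flag vectors of opposite vertices have the same sum. -/
def squareVertex (s : ℕ) : Fin 4 → Finset (ℕ × ℕ) :=
  ![{(s, s + 1)}, {(s, s + 3)}, {(s + 2, s + 3)}, {(s, s + 1), (s + 2, s + 3)}]

/-- The even interval systems that are not a vertex of one of the squares. -/
def apexes (n : ℕ) : Finset (Finset (ℕ × ℕ)) :=
  evenSystems n \ (Icc 1 (n - 3)).biUnion fun s => univ.image (squareVertex s)

/-- The supports of the facet inequalities for the iterated join of the squares and apexes: the
apexes, and the edges of the squares. -/
def joinSupports (n : ℕ) : Finset (Finset (Finset (ℕ × ℕ))) :=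
  (apexes n).image (fun 𝓘 => {𝓘}) ∪ (Icc 1 (n - 3)).biUnion fun s =>
    univ.image fun i => {squareVertex s i, squareVertex s (i + 1)}

theorem image_facetSupport : ∀ n ≤ 5,
    (facetPairs n).image (facetSupport n) = joinSupports n := by
  decide +kernel

theorem incidence_eq_ite : ∀ n ≤ 5, ∀ p ∈ facetPairs n, ∀ 𝓘 ∈ evenSystems n,
    incidence n p.1 p.2 𝓘 = if 𝓘 ∈ facetSupport n p then 1 else 0 := by
  decide +kernel

theorem card_evenSystems : ∀ n ≤ 5, (evenSystems n).card = n.choose (n / 2) := by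
  decide +kernel

theorem card_joinSupports : ∀ n ≤ 5, (joinSupports n).card = n.choose (n / 2) := by
  decide +kernel

set_option synthInstance.maxSize 1000 in
theorem exists_joinSupport_separating : ∀ n ≤ 5, ∀ 𝓘 ∈ evenSystems n, ∀ 𝓙 ∈ evenSystems n,
    𝓘 ≠ 𝓙 → ∃ Z ∈ joinSupports n, 𝓘 ∉ Z ∧ 𝓙 ∈ Z := by
  decide +kernel

theorem squareVertex_mem_evenSystems : ∀ n ≤ 5, ∀ s ∈ Icc 1 (n - 3), ∀ i,
    squareVertex s i ∈ evenSystems n := by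
  decide +kernel

theorem squareVertex_injective : ∀ n ≤ 5, ∀ s ∈ Icc 1 (n - 3), ∀ t ∈ Icc 1 (n - 3), ∀ i j,
    squareVertex s i = squareVertex t j → s = t ∧ i = j := by
  decide +kernel

/-! ### The cone in rank at most six -/

theorem rayVector_add_rayVector_square (n s : ℕ) (i : Fin 4) :
    rayVector n (squareVertex s i) + rayVector n (squareVertex s (i + 2)) =
      rayVector n (squareVertex s (i + 1)) + rayVector n (squareVertex s (i + 3)) := by
  have key : rayVector n (squareVertex s 0) + rayVector n (squareVertex s 2) =
      rayVector n (squareVertex s 1) + rayVector n (squareVertex s 3) := by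
    funext T
    -- `[s, s + 3]` is the disjoint union of `[s, s + 1]` and `[s + 2, s + 3]`
    have h : (∃ t ∈ T.1, s ≤ t ∧ t ≤ s + 3) ↔
        (∃ t ∈ T.1, s ≤ t ∧ t ≤ s + 1) ∨ ∃ t ∈ T.1, s + 2 ≤ t ∧ t ≤ s + 3 := by
      constructor
      · rintro ⟨t, ht, h⟩
        rcases Nat.lt_or_ge t (s + 2) with h' | h'
        · exact Or.inl ⟨t, ht, by omega⟩
        · exact Or.inr ⟨t, ht, by omega⟩
      · rintro (⟨t, ht, h⟩ | ⟨t, ht, h⟩) <;> exact ⟨t, ht, by omega⟩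
    simp only [rayVector, Pi.add_apply, squareVertex, Matrix.cons_val, Meets, mem_insert,
      mem_singleton, forall_eq_or_imp, forall_eq, h]
    by_cases h1 : ∃ t ∈ T.1, s ≤ t ∧ t ≤ s + 1 <;>
      by_cases h2 : ∃ t ∈ T.1, s + 2 ≤ t ∧ t ≤ s + 3 <;> simp [h1, h2]
  fin_cases i
  · exact key
  · exact key.symm.trans (add_comm _ _)
  · exact (add_comm _ _).trans (key.trans (add_comm _ _))
  · exact (add_comm _ _).trans key.symm

/-- In the cone over a square, the inequalities of the four edges imply membership. -/
theorem sum_square_mem {E : Type*} [AddCommGroup E] [Module ℝ E] {C : PointedCone ℝ E}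
    {q : Fin 4 → E} (hq : q 0 + q 2 = q 1 + q 3) (hC : ∀ i, q i ∈ C) (a : Fin 4 → ℝ)
    (ha : ∀ i, 0 ≤ a i + a (i + 1)) : ∑ i, a i • q i ∈ C := by
  have h0 : 0 ≤ a 0 + a 1 := ha 0
  have h1 : 0 ≤ a 1 + a 2 := ha 1
  have h2 : 0 ≤ a 2 + a 3 := ha 2
  have h3 : 0 ≤ a 3 + a 0 := ha 3
  -- the smaller of the coefficients at `1` and `3` is moved to the other diagonal
  set t := min (a 1) (a 3) with ht
  have h4 : t = a 1 ∨ t = a 3 := min_choice _ _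
  have h5 : ∑ i, a i • q i =
      (a 0 + t) • q 0 + (a 1 - t) • q 1 + (a 2 + t) • q 2 + (a 3 - t) • q 3 := by
    have h6 : t • q 0 + t • q 2 = t • q 1 + t • q 3 := by rw [← smul_add, hq, smul_add]
    rw [Fin.sum_univ_four]
    simp only [add_smul, sub_smul]
    rw [← sub_eq_zero] at h6 ⊢
    rw [← neg_eq_zero, ← h6]
    abel
  rw [h5]
  refine C.add_mem (C.add_mem (C.add_mem ?_ ?_) ?_) ?_ <;>
    refine PointedCone.smul_mem _ ?_ (hC _)
  · rcases h4 with h4 | h4 <;> linarith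
  · linarith [min_le_left (a 1) (a 3)]
  · rcases h4 with h4 | h4 <;> linarith
  · linarith [min_le_right (a 1) (a 3)]

theorem mem_facetPairs {n : ℕ} {p : Finset ℕ × Finset ℕ} :
    p ∈ facetPairs n ↔ p = (∅, Icc 1 n) ∨ IsFacetPair n p.1 p.2 := by
  simp only [facetPairs, mem_insert, mem_filter, mem_product, mem_powerset]
  refine or_congr_right ⟨fun h => h.2, fun h => ⟨⟨h.subset'.trans h.subset, h.subset⟩, h⟩⟩

theorem subset_of_mem_facetPairs {n : ℕ} {p : Finset ℕ × Finset ℕ} (hp : p ∈ facetPairs n) :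
    p.1 ⊆ p.2 ∧ p.2 ⊆ Icc 1 n := by
  rcases mem_facetPairs.1 hp with rfl | h
  · exact ⟨empty_subset _, Subset.rfl⟩
  · exact ⟨h.subset', h.subset⟩

theorem mem_facetForms {n : ℕ} {φ : FlagSpace n →ₗ[ℝ] ℝ} :
    φ ∈ facetForms n ↔ ∃ p ∈ facetPairs n, φ = facetForm n p.1 p.2 := by
  have h0 : ∑ Q ∈ (Icc 1 n).powerset, LForm n Q = facetForm n ∅ (Icc 1 n) := by
    simp [facetForm]
  constructor
  · rintro (h | ⟨M, V, h, rfl⟩)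
    · exact ⟨(∅, Icc 1 n), mem_facetPairs.2 (Or.inl rfl), h.trans h0⟩
    · exact ⟨(M, V), mem_facetPairs.2 (Or.inr h), rfl⟩
  · rintro ⟨p, hp, rfl⟩
    rcases mem_facetPairs.1 hp with rfl | h
    · exact Or.inl h0.symm
    · exact Or.inr ⟨p.1, p.2, h, rfl⟩

theorem GradedPoset.IsEulerian.facetForm_flagVector_nonneg {P : GradedPoset} (hP : P.IsEulerian)
    {n : ℕ} (hn : P.rank = n + 1) {p : Finset ℕ × Finset ℕ} (hp : p ∈ facetPairs n) :
    0 ≤ facetForm n p.1 p.2 (flagVector n P) := by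
  rcases mem_facetPairs.1 hp with rfl | h
  · have h1 := sum_LForm_eq_apply (flagVector n P) ⟨∅, empty_mem_powerset _⟩
    rw [sdiff_empty] at h1
    simp only [facetForm, empty_subset, filter_true, LinearMap.smul_apply, LinearMap.sum_apply,
      h1]
    simp [flagVector]
  · exact hP.facetForm_nonneg hn h

/-- Membership in the closed cone implies the linear relations and the inequalities that hold for
all Eulerian posets. -/
theorem mem_span_and_nonneg_of_mem_eulerianCone {n : ℕ} {v : FlagSpace n}
    (hv : v ∈ eulerianCone n) :
    v ∈ Submodule.span ℝ (rayVector n '' (evenSystems n : Set (Finset (ℕ × ℕ)))) ∧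
      ∀ p ∈ facetPairs n, 0 ≤ facetForm n p.1 p.2 v := by
  let H : PointedCone ℝ (FlagSpace n) :=
    (⨅ Q ∈ {Q : Finset ℕ | Q ⊆ Icc 1 n ∧ ¬ IsEvenSet Q},
      (PointedCone.ofSubmodule (LinearMap.ker (LForm n Q)))) ⊓
    ⨅ p ∈ facetPairs n, (PointedCone.positive ℝ ℝ).comap (facetForm n p.1 p.2)
  have hH : ∀ w, w ∈ H ↔ (∀ Q ⊆ Icc 1 n, ¬ IsEvenSet Q → LForm n Q w = 0) ∧
      ∀ p ∈ facetPairs n, 0 ≤ facetForm n p.1 p.2 w := by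
    intro w
    simp only [H, Submodule.mem_inf, Submodule.mem_iInf, Set.mem_ofPred_eq, and_imp]
    rfl
  have hle : PointedCone.hull ℝ
      {v | ∃ P : GradedPoset, P.rank = n + 1 ∧ P.IsEulerian ∧ v = flagVector n P} ≤ H := by
    refine Submodule.span_le.2 ?_
    rintro _ ⟨P, hn, hP, rfl⟩
    exact (hH _).2 ⟨fun Q hQ hodd => hP.LForm_eq_zero hn hQ hodd,
      fun p hp => hP.facetForm_flagVector_nonneg hn hp⟩
  have hclosed : IsClosed (H : Set (FlagSpace n)) := by
    have h1 : (H : Set (FlagSpace n)) =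
        {w | ∀ Q ⊆ Icc 1 n, ¬ IsEvenSet Q → LForm n Q w = 0} ∩
        {w | ∀ p ∈ facetPairs n, 0 ≤ facetForm n p.1 p.2 w} := Set.ext hH
    rw [h1]
    simp only [Set.ofPred_forall]
    refine IsClosed.inter ?_ ?_
    · exact isClosed_iInter fun Q => isClosed_iInter fun _ => isClosed_iInter fun _ =>
        isClosed_eq (LinearMap.continuous_of_finiteDimensional _) continuous_const
    · exact isClosed_iInter fun p => isClosed_iInter fun _ =>
        isClosed_le continuous_const (LinearMap.continuous_of_finiteDimensional _)
  have hvH : v ∈ H := closure_minimal hle hclosed (PointedCone.mem_closure.1 hv)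
  obtain ⟨h1, h2⟩ := (hH v).1 hvH
  refine ⟨?_, h2⟩
  have h3 : (evenSystems n : Set (Finset (ℕ × ℕ))) = {𝓘 | IsEvenIntervalSystem n 𝓘} :=
    Set.ext fun 𝓘 => mem_evenSystems
  rw [h3]
  exact mem_span_rayVector h1

theorem facetForm_rayVector_eq_ite {n : ℕ} (hn : n ≤ 5) {p : Finset ℕ × Finset ℕ}
    (hp : p ∈ facetPairs n) {𝓘 : Finset (ℕ × ℕ)} (h𝓘 : 𝓘 ∈ evenSystems n) :
    facetForm n p.1 p.2 (rayVector n 𝓘) = if 𝓘 ∈ facetSupport n p then 1 else 0 := by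
  rw [facetForm_rayVector (subset_of_mem_facetPairs hp).1 (subset_of_mem_facetPairs hp).2,
    incidence_eq_ite n hn p hp 𝓘 h𝓘]
  split_ifs <;> simp

/-- The inequalities cut the cone generated by the ray vectors out of their span: the coefficients
at the apexes are nonnegative, and the squares are handled one by one. -/
theorem mem_hull_of_nonneg {n : ℕ} (hn : n ≤ 5) {v : FlagSpace n}
    (hv : v ∈ Submodule.span ℝ (rayVector n '' (evenSystems n : Set (Finset (ℕ × ℕ)))))
    (hpos : ∀ p ∈ facetPairs n, 0 ≤ facetForm n p.1 p.2 v) :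
    v ∈ PointedCone.hull ℝ (rayVector n '' (evenSystems n : Set (Finset (ℕ × ℕ)))) := by
  obtain ⟨a, rfl⟩ : ∃ a : Finset (ℕ × ℕ) → ℝ,
      ∑ 𝓘 ∈ evenSystems n, a 𝓘 • rayVector n 𝓘 = v := by
    have h1 := Submodule.mem_span_image_finset_iff_exists_fun ℝ |>.1 hv
    obtain ⟨c, rfl⟩ := h1
    refine ⟨fun 𝓘 => if h : 𝓘 ∈ evenSystems n then c ⟨𝓘, h⟩ else 0, ?_⟩
    rw [← sum_coe_sort (evenSystems n)]
    refine sum_congr rfl fun 𝓘 _ => ?_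
    dsimp only
    rw [dif_pos 𝓘.2]
  have hsum : ∀ Z ∈ joinSupports n, 0 ≤ ∑ 𝓘 ∈ Z, a 𝓘 := by
    intro Z hZ
    rw [← image_facetSupport n hn] at hZ
    obtain ⟨p, hp, rfl⟩ := mem_image.1 hZ
    have h1 := hpos p hp
    have h2 : ∀ 𝓘 ∈ evenSystems n, facetForm n p.1 p.2 (a 𝓘 • rayVector n 𝓘) =
        if 𝓘 ∈ facetSupport n p then a 𝓘 else 0 := fun 𝓘 h𝓘 => by
      rw [map_smul, facetForm_rayVector_eq_ite hn hp h𝓘, smul_eq_mul, mul_ite, mul_one, mul_zero]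
    rwa [map_sum, sum_congr rfl h2, sum_ite_mem,
      inter_eq_right.2 (show facetSupport n p ⊆ evenSystems n from filter_subset _ _)] at h1
  have hmem : ∀ 𝓘 ∈ evenSystems n, rayVector n 𝓘 ∈
      PointedCone.hull ℝ (rayVector n '' (evenSystems n : Set (Finset (ℕ × ℕ)))) :=
    fun 𝓘 h𝓘 => PointedCone.subset_hull ⟨𝓘, h𝓘, rfl⟩
  have hsq := squareVertex_mem_evenSystems n hn
  have hinj := squareVertex_injective n hn
  have hii : ∀ i : Fin 4, i ≠ i + 1 := by decide
  have hsub : (Icc 1 (n - 3)).biUnion (fun s => univ.image (squareVertex s)) ⊆ evenSystems n := by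
    intro 𝓘 h
    obtain ⟨s, hs, h⟩ := mem_biUnion.1 h
    obtain ⟨i, -, rfl⟩ := mem_image.1 h
    exact hsq s hs i
  rw [← sum_sdiff hsub, sum_biUnion]
  · refine Submodule.add_mem _ (Submodule.sum_mem _ fun 𝓘 h𝓘 => ?_)
      (Submodule.sum_mem _ fun s hs => ?_)
    · refine PointedCone.smul_mem _ ?_ (hmem 𝓘 (Finset.mem_sdiff.1 h𝓘).1)
      have h1 := hsum {𝓘} (mem_union_left _ (mem_image.2 ⟨𝓘, h𝓘, rfl⟩))
      rwa [sum_singleton] at h1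
    · rw [sum_image fun i _ j _ h => (hinj s hs s hs i j h).2]
      refine sum_square_mem (q := fun i => rayVector n (squareVertex s i))
        (rayVector_add_rayVector_square n s 0) (fun i => hmem _ (hsq s hs i))
        (fun i => a (squareVertex s i)) fun i => ?_
      have h1 := hsum {squareVertex s i, squareVertex s (i + 1)} (mem_union_right _
        (mem_biUnion.2 ⟨s, hs, mem_image.2 ⟨i, mem_univ _, rfl⟩⟩))
      rwa [sum_pair fun h => hii i (hinj s hs s hs _ _ h).2] at h1
  · intro s hs t ht hst
    refine disjoint_left.2 fun 𝓘 h1 h2 => hst ?_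
    obtain ⟨i, -, rfl⟩ := mem_image.1 h1
    obtain ⟨j, -, h⟩ := mem_image.1 h2
    exact (hinj t ht s hs j i h).1.symm

/-- The even interval systems on which a linear form does not vanish. -/
noncomputable def formSupport (n : ℕ) (φ : FlagSpace n →ₗ[ℝ] ℝ) : Finset (Finset (ℕ × ℕ)) :=
  open Classical in {𝓘 ∈ evenSystems n | φ (rayVector n 𝓘) ≠ 0}

theorem formSupport_facetForm {n : ℕ} (hn : n ≤ 5) {p : Finset ℕ × Finset ℕ}
    (hp : p ∈ facetPairs n) : formSupport n (facetForm n p.1 p.2) = facetSupport n p := by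
  ext 𝓘
  simp only [formSupport, mem_filter]
  constructor
  · rintro ⟨h𝓘, h⟩
    rw [facetForm_rayVector_eq_ite hn hp h𝓘] at h
    by_contra hcon
    exact h (if_neg hcon)
  · intro h
    have h𝓘 := (mem_filter.1 h).1
    refine ⟨h𝓘, ?_⟩
    rw [facetForm_rayVector_eq_ite hn hp h𝓘, if_pos h]
    exact one_ne_zero

theorem image_formSupport {n : ℕ} (hn : n ≤ 5) :
    formSupport n '' facetForms n = (joinSupports n : Set (Finset (Finset (ℕ × ℕ)))) := by
  ext Z
  rw [← image_facetSupport n hn, mem_coe, mem_image]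
  constructor
  · rintro ⟨φ, hφ, rfl⟩
    obtain ⟨p, hp, rfl⟩ := mem_facetForms.1 hφ
    exact ⟨p, hp, (formSupport_facetForm hn hp).symm⟩
  · rintro ⟨p, hp, rfl⟩
    exact ⟨_, mem_facetForms.2 ⟨p, hp, rfl⟩, formSupport_facetForm hn hp⟩

theorem isDualPair_eulerianCone {n : ℕ} (hn : n ≤ 5) :
    IsDualPair (eulerianCone n) (evenSystems n) (rayVector n) (facetForms n) (formSupport n) := by
  have hle : PointedCone.hull ℝ (rayVector n '' (evenSystems n : Set (Finset (ℕ × ℕ)))) ≤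
      eulerianCone n := by
    refine Submodule.span_le.2 ?_
    rintro _ ⟨𝓘, h𝓘, rfl⟩
    exact rayVector_mem_eulerianCone (mem_evenSystems.1 h𝓘)
  refine ⟨le_antisymm (fun v hv => ?_) hle, fun φ _ => filter_subset _ _, fun φ hφ 𝓘 h𝓘 => ?_,
    fun v hv hpos => hle (mem_hull_of_nonneg hn hv fun p hp => hpos _ (mem_facetForms.2
      ⟨p, hp, rfl⟩))⟩
  · obtain ⟨h1, h2⟩ := mem_span_and_nonneg_of_mem_eulerianCone hv
    exact mem_hull_of_nonneg hn h1 h2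
  · obtain ⟨p, hp, rfl⟩ := mem_facetForms.1 hφ
    rw [formSupport_facetForm hn hp, facetForm_rayVector_eq_ite hn hp h𝓘]

theorem rayVector_ne_zero {n : ℕ} {𝓘 : Finset (ℕ × ℕ)} (h𝓘 : IsEvenIntervalSystem n 𝓘) :
    rayVector n 𝓘 ≠ 0 := by
  intro h
  have h1 := congrFun h ⟨Icc 1 n, mem_powerset_self _⟩
  have h2 : Meets (Icc 1 n) 𝓘 := fun I hI =>
    have h3 := h𝓘.1.1 I hI
    ⟨I.1, mem_Icc.2 ⟨h3.1, h3.2.1.trans h3.2.2⟩, le_rfl, h3.2.1⟩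
  simp [rayVector, h2] at h1

/-- The forms define facets: the two ray vectors at the ends of an edge of a square differ by the
same vector as those at the ends of the opposite edge. -/
theorem isFacet_of_mem_facetForms {n : ℕ} (hn : n ≤ 5) {φ : FlagSpace n →ₗ[ℝ] ℝ}
    (hφ : φ ∈ facetForms n) : IsFacet (eulerianCone n) (IsDualPair.kerFace (eulerianCone n) φ) := by
  refine (isDualPair_eulerianCone hn).isFacet_kerFace hφ ?_
  have hZ : formSupport n φ ∈ joinSupports n := by
    rw [← mem_coe, ← image_formSupport hn]
    exact ⟨φ, hφ, rfl⟩
  rcases mem_union.1 hZ with hZ | hZ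
  · obtain ⟨𝓘, -, h⟩ := mem_image.1 hZ
    rw [← h]
    refine ⟨𝓘, mem_singleton_self _, fun 𝓙 h𝓙 => ?_⟩
    rw [mem_singleton.1 h𝓙, sub_self]
    exact Submodule.zero_mem _
  · obtain ⟨s, hs, hZ⟩ := mem_biUnion.1 hZ
    obtain ⟨i, -, h⟩ := mem_image.1 hZ
    rw [← h]
    refine ⟨squareVertex s i, mem_insert_self _ _, fun 𝓙 h𝓙 => ?_⟩
    rcases mem_insert.1 h𝓙 with rfl | h𝓙
    · rw [sub_self]
      exact Submodule.zero_mem _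
    · rw [mem_singleton.1 h𝓙]
      have hrel : rayVector n (squareVertex s (i + 1)) - rayVector n (squareVertex s i) =
          rayVector n (squareVertex s (i + 2)) - rayVector n (squareVertex s (i + 3)) := by
        rw [sub_eq_sub_iff_add_eq_add, ← rayVector_add_rayVector_square, add_comm]
      have hne : ∀ k : Fin 4, k ≠ 0 → k ≠ 1 → rayVector n (squareVertex s (i + k)) ∈
          Submodule.span ℝ (rayVector n '' ((evenSystems n \
            {squareVertex s i, squareVertex s (i + 1)} : Finset (Finset (ℕ × ℕ))) :
              Set (Finset (ℕ × ℕ)))) := by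
        intro k hk0 hk1
        refine Submodule.subset_span ⟨_, mem_coe.2 (Finset.mem_sdiff.2
          ⟨squareVertex_mem_evenSystems n hn s hs _, fun hmem => ?_⟩), rfl⟩
        rcases mem_insert.1 hmem with h | h
        · have := (squareVertex_injective n hn s hs s hs _ _ h).2
          exact hk0 (by simpa using this)
        · have := (squareVertex_injective n hn s hs s hs _ _ (mem_singleton.1 h)).2
          exact hk1 (by simpa using this)
      rw [hrel]
      exact Submodule.sub_mem _ (hne 2 (by decide) (by decide)) (hne 3 (by decide) (by decide))

theorem mainTheorem5 (n : ℕ) (hn : n + 1 ≤ 6) :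
    (eulerianCone n).FG ∧
    -- the limits that define the flag vectors of the doubled limit posets exist
    (∀ 𝓘 : Finset (ℕ × ℕ), IsEvenIntervalSystem n 𝓘 →
      Tendsto (fun N : ℕ+ => normalizedDoubleVector n 𝓘 N) atTop
        (𝓝 (doubledLimitVector n 𝓘))) ∧
    -- the extreme rays
    {R | IsExtremeRay (eulerianCone n) R} =
      {R | ∃ 𝓘 : Finset (ℕ × ℕ), IsEvenIntervalSystem n 𝓘 ∧
        R = PointedCone.hull ℝ {doubledLimitVector n 𝓘}} ∧
    {R | IsExtremeRay (eulerianCone n) R}.ncard = n.choose (n / 2) ∧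
    -- the facets
    (∀ φ ∈ facetForms n, ∀ v ∈ eulerianCone n, 0 ≤ φ v) ∧
    {F | IsFacet (eulerianCone n) F} =
      {F | ∃ φ ∈ facetForms n,
        F = eulerianCone n ⊓ PointedCone.ofSubmodule (LinearMap.ker φ)} ∧
    {F | IsFacet (eulerianCone n) F}.ncard = n.choose (n / 2) := by
  have hn : n ≤ 5 := by omega
  have h := isDualPair_eulerianCone hn
  have hbounds : ∀ {𝓘 : Finset (ℕ × ℕ)}, IsEvenIntervalSystem n 𝓘 →
      ∀ I ∈ 𝓘, 1 ≤ I.1 ∧ I.2 ≤ n := fun h𝓘 I hI => ⟨(h𝓘.1.1 I hI).1, (h𝓘.1.1 I hI).2.2⟩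
  have h0 : ∀ 𝓘 ∈ evenSystems n, rayVector n 𝓘 ≠ 0 := fun 𝓘 h𝓘 =>
    rayVector_ne_zero (mem_evenSystems.1 h𝓘)
  have hsep : ∀ 𝓘 ∈ evenSystems n, ∀ 𝓙 ∈ evenSystems n, 𝓘 ≠ 𝓙 →
      ∃ φ ∈ facetForms n, 𝓘 ∉ formSupport n φ ∧ 𝓙 ∈ formSupport n φ := by
    intro 𝓘 h𝓘 𝓙 h𝓙 hne
    obtain ⟨Z, hZ, hZ'⟩ := exists_joinSupport_separating n hn 𝓘 h𝓘 𝓙 h𝓙 hne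
    rw [← mem_coe, ← image_formSupport hn] at hZ
    obtain ⟨φ, hφ, rfl⟩ := hZ
    exact ⟨φ, hφ, hZ'⟩
  have hrays : {R | IsExtremeRay (eulerianCone n) R} =
      (fun 𝓘 => PointedCone.hull ℝ {rayVector n 𝓘}) '' evenSystems n := by
    ext R
    constructor
    · intro hR
      obtain ⟨𝓘, h𝓘, rfl⟩ := h.eq_hull_of_isExtremeRay h0 hR
      exact ⟨𝓘, h𝓘, rfl⟩
    · rintro ⟨𝓘, h𝓘, rfl⟩
      exact h.isExtremeRay hsep h𝓘 (h0 𝓘 h𝓘)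
  have hfacets : {F | IsFacet (eulerianCone n) F} =
      {F | ∃ φ ∈ facetForms n, F = IsDualPair.kerFace (eulerianCone n) φ} := by
    ext F
    constructor
    · exact fun hF => h.eq_kerFace_of_isFacet (fun φ hφ => isFacet_of_mem_facetForms hn hφ) hF
    · rintro ⟨φ, hφ, rfl⟩
      exact isFacet_of_mem_facetForms hn hφ
  refine ⟨h.fg, fun 𝓘 h𝓘 => ?_, ?_, ?_, fun φ hφ v hv => h.nonneg hφ hv, hfacets, ?_⟩
  · rw [doubledLimitVector_eq (hbounds h𝓘)]
    exact tendsto_normalizedDoubleVector (hbounds h𝓘)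
  · rw [hrays]
    ext R
    constructor
    · rintro ⟨𝓘, h𝓘, rfl⟩
      have h𝓘 := mem_evenSystems.1 h𝓘
      exact ⟨𝓘, h𝓘, by rw [doubledLimitVector_eq (hbounds h𝓘)]⟩
    · rintro ⟨𝓘, h𝓘, rfl⟩
      exact ⟨𝓘, mem_evenSystems.2 h𝓘, by rw [doubledLimitVector_eq (hbounds h𝓘)]⟩
  · rw [hrays, (h.injOn_hull_singleton hsep).ncard_image, Set.ncard_coe_finset,
      card_evenSystems n hn]
  · rw [hfacets, h.ncard_kerFace, image_formSupport hn, Set.ncard_coe_finset,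
      card_joinSupports n hn]
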